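/- For $R>0$ let $\Gamma_R=\{\lambda\in\mathbb Z^2 : R-\tfrac1{\sqrt2}<\|\lambda\|<R+\tfrac1{\sqrt2}\}$, and for $\lambda\in\Gamma_R$ write $\lambda=(R+r_\lambda)e^{i\theta_\lambda}$ (identifying $\mathbb R^2=\mathbb C$) with $r_\lambda=\|\lambda\|-R$ and $\theta_\lambda\in[0,2\pi)$ (with the convention $\theta_0=0$; the origin lies in $\Gamma_R$ only if $R<1/\sqrt2$). For $c<d$, the condition $\theta_\lambda \bmod 2\pi\in[c,d]$ means that $\theta_\lambda+2\pi k\in[c,d]$ for some $k\in\mathbb Z$. Then for every $\varepsilon>0$ there is a constant $C>0$, depending only on $\varepsilon$, such that for all $R>0$, all real $c<d$ with $R^{-1/2}\le|d-c|\le 2\pi$, and every closed interval $I=[a,b]\subseteq[-\tfrac1{\sqrt2},\tfrac1{\sqrt2}]$ (with $a\le b$ and $|I|=b-a$), $$\left|\#\{\lambda\in\Gamma_R : \theta_\lambda \bmod 2\pi\in[c,d],\ r_\lambda\in I\}-2\pi\sqrt2\,R\cdot\frac{|d-c|}{2\pi}\cdot\frac{|I|}{\sqrt2}\right|\le C\,|d-c|^{1/3}R^{2/3+\varepsilon}.$$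 -/

import Mathlib

namespace GaussCircle

/-- The point `(m, n)` of the lattice `ℤ²`, seen in the plane `ℝ² = ℂ`. -/
noncomputable def toPlane (p : ℤ × ℤ) : ℂ := ⟨(p.1 : ℝ), (p.2 : ℝ)⟩

/-- `Γ_R`: the lattice points in the open annulus `R - 1/√2 < ‖z‖ < R + 1/√2`. -/
def latticeAnnulus (R : ℝ) : Set (ℤ × ℤ) :=
  {p | R - 1 / √2 < ‖toPlane p‖ ∧ ‖toPlane p‖ < R + 1 / √2}

/-- The shifted radial coordinate `r_λ`, with `‖λ‖ = R + r_λ`. -/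
noncomputable def radial (R : ℝ) (p : ℤ × ℤ) : ℝ := ‖toPlane p‖ - R

/-- The polar angle `θ_λ ∈ [0, 2π)` (with value `0` at the origin). -/
noncomputable def angle (p : ℤ × ℤ) : ℝ :=
  toIcoMod Real.two_pi_pos 0 (Complex.arg (toPlane p))

/-- `x mod 2π ∈ [c, d]`: some representative of the class of `x` modulo `2π` lies in `[c, d]`. -/
def ModTwoPiMem (x c d : ℝ) : Prop := ∃ k : ℤ, x + 2 * Real.pi * k ∈ Set.Icc c d

/-- The points `λ` of `Γ_R` with `θ_λ mod 2π ∈ [c, d]` and `r_λ ∈ [a, b]`. -/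
def sectorPoints (R c d a b : ℝ) : Set (ℤ × ℤ) :=
  {p | p ∈ latticeAnnulus R ∧ ModTwoPiMem (angle p) c d ∧ radial R p ∈ Set.Icc a b}

theorem angle_mem (p : ℤ × ℤ) : angle p ∈ Set.Ico 0 (2 * Real.pi) := by
  simpa [angle] using toIcoMod_mem_Ico Real.two_pi_pos 0 (Complex.arg (toPlane p))

/-- The defining relation `λ = (R + r_λ) e^{i θ_λ}`. -/
theorem polar_eq (R : ℝ) (p : ℤ × ℤ) :
    toPlane p = ((R + radial R p : ℝ) : ℂ) * Complex.exp ((angle p : ℂ) * Complex.I) := by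
  have h : Complex.exp ((angle p : ℂ) * Complex.I)
      = Complex.exp ((Complex.arg (toPlane p) : ℂ) * Complex.I) := by
    rw [Complex.exp_eq_exp_iff_exists_int]
    refine ⟨-toIcoDiv Real.two_pi_pos 0 (Complex.arg (toPlane p)), ?_⟩
    simp only [angle, toIcoMod, zsmul_eq_mul]
    push_cast
    ring
  rw [h]
  simp [radial, Complex.norm_mul_exp_arg_mul_I]

theorem latticeAnnulus_finite (R : ℝ) : (latticeAnnulus R).Finite := by
  set N : ℤ := ⌈R + 1 / √2⌉ with hN
  refine Set.Finite.subset ((Set.finite_Icc (-N) N).prod (Set.finite_Icc (-N) N)) ?_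
  rintro p ⟨-, h⟩
  have hc : R + 1 / √2 ≤ (N : ℝ) := Int.le_ceil _
  have h1 : |(p.1 : ℝ)| ≤ N := (Complex.abs_re_le_norm (toPlane p)).trans (h.le.trans hc)
  have h2 : |(p.2 : ℝ)| ≤ N := (Complex.abs_im_le_norm (toPlane p)).trans (h.le.trans hc)
  rw [abs_le] at h1 h2
  exact ⟨⟨by exact_mod_cast h1.1, by exact_mod_cast h1.2⟩,
    ⟨by exact_mod_cast h2.1, by exact_mod_cast h2.2⟩⟩

/-- The set that is counted is finite, so its `Set.ncard` is its true number of elements. -/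
theorem sectorPoints_finite (R c d a b : ℝ) : (sectorPoints R c d a b).Finite :=
  (latticeAnnulus_finite R).subset fun _ h => h.1

end GaussCircle

/-! The bound proved for large `R` is stronger than the one claimed. With `δ = d - c` and `0 < ε ≤
1/3`, the error is `O(δ R^(2/3+ε) + R^(1/2))`. As `δ` is bounded, `δ = O(δ^(1/3))`, and `R^(-1/2) ≤
δ` gives `R^(1/2) ≤ δ^(1/3) R^(2/3)`. Bounded `R` only affects the constant.

A sector between the angles `π/4` and `3π/4` is, up to boundedly many columns, the part of the
annulus above the integers `x` in `[R cos d, R cos c]`. By `card_Icc_ceil_floor`, the column above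
`x` contains its height minus two values of the sawtooth `ψ(x) = {x} - 1/2`. The heights sum to `(ρ₂
- ρ₁) R (d - c) + O(1)`, because they follow the derivative of `arcsin (x / R)`.

The sawtooth sums run along circles, whose second differences have size `1/ρ`. The inequality
`kusmin_landau` leads to van der Corput's bound `norm_sum_unitExp_le_of_second_diff` for exponential
sums. To pass from these to `ψ`, one uses finite differences with step `u` of its antiderivative,
the periodic Bernoulli function of degree two, whose Fourier series converges absolutely
(`abs_sum_sawtooth_le`). With `u = l^(1/3)` and `l = 1/ρ`, a sum over `L` columns is `O(L ρ^(ε-1/3)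
+ ρ^(1/2))`.

Quarter turns preserve `ℤ²` and carry the other quadrants to this one. A sector of angle at most
`2π` is glued from at most five pieces. -/

namespace GaussCircle

/-! ### Exponential sums -/

/-- The additive character `x ↦ e^{2πix}`. -/
noncomputable def unitExp (x : ℝ) : ℂ := Complex.exp (((2 * Real.pi * x : ℝ) : ℂ) * Complex.I)

theorem norm_unitExp (x : ℝ) : ‖unitExp x‖ = 1 := Complex.norm_exp_ofReal_mul_I _

theorem unitExp_add (x y : ℝ) : unitExp (x + y) = unitExp x * unitExp y := by
  rw [unitExp, unitExp, unitExp, ← Complex.exp_add]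
  congr 1
  push_cast
  ring

theorem unitExp_int (k : ℤ) : unitExp k = 1 := by
  rw [unitExp, Complex.exp_eq_one_iff]
  exact ⟨k, by push_cast; ring⟩

theorem unitExp_re (x : ℝ) : (unitExp x).re = Real.cos (2 * Real.pi * x) :=
  Complex.exp_ofReal_mul_I_re _

theorem unitExp_neg (x : ℝ) : unitExp (-x) = (starRingEnd ℂ) (unitExp x) := by
  rw [unitExp, unitExp, ← Complex.exp_conj]
  congr 1
  rw [map_mul, Complex.conj_ofReal, Complex.conj_I]
  push_cast
  ring

theorem norm_sum_unitExp_le {ι : Type*} (s : Finset ι) (f : ι → ℝ) :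
    ‖∑ i ∈ s, unitExp (f i)‖ ≤ s.card := by
  refine (norm_sum_le _ _).trans ?_
  simp [norm_unitExp]

/-! ### The Kusmin–Landau and van der Corput inequalities. -/

/-- The cotangent `cot (πx)`. -/
noncomputable def cotPi (x : ℝ) : ℝ := Real.cos (Real.pi * x) / Real.sin (Real.pi * x)

theorem two_mul_le_sin_pi {θ x : ℝ} (hθ : 0 < θ) (h1 : θ ≤ x) (h2 : x ≤ 1 - θ) :
    2 * θ ≤ Real.sin (Real.pi * x) := by
  have hpi := Real.pi_pos
  rcases le_total x (1 / 2) with h | h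
  · have := Real.mul_le_sin (x := Real.pi * x) (by nlinarith) (by nlinarith)
    have e : 2 / Real.pi * (Real.pi * x) = 2 * x := by field_simp
    linarith
  · have := Real.mul_le_sin (x := Real.pi * (1 - x)) (by nlinarith) (by nlinarith)
    have e : 2 / Real.pi * (Real.pi * (1 - x)) = 2 * (1 - x) := by field_simp
    have e2 : Real.sin (Real.pi * (1 - x)) = Real.sin (Real.pi * x) := by
      rw [mul_sub, mul_one, Real.sin_pi_sub]
    linarith

theorem cotPi_antitone {x y : ℝ} (hx : 0 < x) (hxy : x ≤ y) (hy : y < 1) : cotPi y ≤ cotPi x := by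
  have hpi := Real.pi_pos
  have s1 : 0 < Real.sin (Real.pi * x) :=
    Real.sin_pos_of_pos_of_lt_pi (by positivity) (by nlinarith)
  have s2 : 0 < Real.sin (Real.pi * y) :=
    Real.sin_pos_of_pos_of_lt_pi (by nlinarith) (by nlinarith)
  rw [cotPi, cotPi, div_le_div_iff₀ s2 s1]
  have h : 0 ≤ Real.sin (Real.pi * y - Real.pi * x) :=
    Real.sin_nonneg_of_nonneg_of_le_pi (by nlinarith) (by nlinarith)
  rw [Real.sin_sub] at h
  linarith

/-- The value `1 / (1 - e^{2πix})`. -/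
noncomputable def invOneSubExp (x : ℝ) : ℂ := (1 + (cotPi x : ℂ) * Complex.I) / 2

/-- With `α = πx`, the half-angle identity is `1 - e^{2iα} = 2 sin α (sin α - i cos α)`. The
constant real part leaves only the cotangent to vary, which is monotone. -/
theorem invOneSubExp_mul {x : ℝ} (hx : Real.sin (Real.pi * x) ≠ 0) :
    invOneSubExp x * (1 - unitExp x) = 1 := by
  have h : unitExp x = (Real.cos (Real.pi * x) + Real.sin (Real.pi * x) * Complex.I) ^ 2 := by
    rw [unitExp, Complex.ofReal_cos, Complex.ofReal_sin, ← Complex.exp_mul_I, ← Complex.exp_nat_mul]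
    congr 1
    push_cast
    ring
  have hs : (Real.sin (Real.pi * x) : ℂ) ≠ 0 := by exact_mod_cast hx
  have hsc : (Real.cos (Real.pi * x) : ℂ) ^ 2 = 1 - (Real.sin (Real.pi * x) : ℂ) ^ 2 := by
    have := Real.sin_sq_add_cos_sq (Real.pi * x)
    rw [eq_sub_iff_add_eq, add_comm]
    exact_mod_cast this
  rw [invOneSubExp, cotPi, h]
  push_cast at hs hsc ⊢
  generalize Complex.cos (Real.pi * x) = c at *
  generalize Complex.sin (Real.pi * x) = s at *
  have hI := Complex.I_sq
  have e1 : 1 - (c + s * Complex.I) ^ 2 = 2 * s * (s - c * Complex.I) := by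
    linear_combination -hsc - s ^ 2 * hI
  have e2 : (s + c * Complex.I) * (s - c * Complex.I) = 1 := by
    linear_combination hsc - c ^ 2 * hI
  rw [e1]
  field_simp
  exact e2

theorem norm_invOneSubExp_le {θ x : ℝ} (hθ : 0 < θ) (h1 : θ ≤ x) (h2 : x ≤ 1 - θ) :
    ‖invOneSubExp x‖ ≤ 1 / (4 * θ) := by
  have hs := two_mul_le_sin_pi hθ h1 h2
  have hs0 : 0 < Real.sin (Real.pi * x) := by linarith
  have h : ‖invOneSubExp x‖ ^ 2 = (1 / (2 * Real.sin (Real.pi * x))) ^ 2 := by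
    rw [← Complex.normSq_eq_norm_sq, invOneSubExp, map_div₀, Complex.normSq_apply, cotPi]
    have := Real.sin_sq_add_cos_sq (Real.pi * x)
    simp only [Complex.add_re, Complex.one_re, Complex.mul_re, Complex.ofReal_re, Complex.I_re,
      Complex.ofReal_im, Complex.I_im, Complex.add_im, Complex.one_im, Complex.mul_im]
    norm_num
    field_simp
    linarith
  have h' := (sq_eq_sq₀ (norm_nonneg _) (by positivity)).1 h
  rw [h']
  exact one_div_le_one_div_of_le (by positivity) (by linarith)

theorem norm_invOneSubExp_sub (x y : ℝ) :
    ‖invOneSubExp x - invOneSubExp y‖ = |cotPi x - cotPi y| / 2 := by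
  have : invOneSubExp x - invOneSubExp y = ((cotPi x - cotPi y : ℝ) : ℂ) * Complex.I / 2 := by
    rw [invOneSubExp, invOneSubExp]; push_cast; ring
  rw [this, norm_div, norm_mul, Complex.norm_real, Complex.norm_I, Real.norm_eq_abs, mul_one]
  simp

theorem abs_cotPi_le (x : ℝ) : |cotPi x| ≤ 2 * ‖invOneSubExp x‖ := by
  have h := Complex.abs_im_le_norm (invOneSubExp x)
  have : (invOneSubExp x).im = cotPi x / 2 := by simp [invOneSubExp]
  rw [this, abs_div, abs_two] at h
  linarith

/-- The Kusmin–Landau inequality. -/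
theorem kusmin_landau (f : ℕ → ℝ) (n : ℕ) (k : ℤ) {θ : ℝ} (hθ : 0 < θ)
    (h1 : ∀ i < n, k + θ ≤ f (i + 1) - f i) (h2 : ∀ i < n, f (i + 1) - f i ≤ k + 1 - θ)
    (hm : ∀ i, i + 1 < n → f (i + 1) - f i ≤ f (i + 2) - f (i + 1)) :
    ‖∑ i ∈ Finset.range n, unitExp (f i)‖ ≤ 1 / θ := by
  rcases Nat.eq_zero_or_pos n with rfl | hn
  · simpa using hθ.le
  set g : ℕ → ℝ := fun i => f (i + 1) - f i - k with hg
  have g1 : ∀ i < n, θ ≤ g i := fun i hi => by have := h1 i hi; simp only [hg]; linarith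
  have g2 : ∀ i < n, g i ≤ 1 - θ := fun i hi => by have := h2 i hi; simp only [hg]; linarith
  -- Since `e(f (i+1)) = e(f i) e(g i)`, each term is a weighted difference of consecutive values,
  -- ready for summation by parts.
  have step : ∀ i < n, unitExp (f i)
      = invOneSubExp (g i) * unitExp (f i) - invOneSubExp (g i) * unitExp (f (i + 1)) := by
    intro i hi
    have e : unitExp (f (i + 1)) = unitExp (f i) * unitExp (g i) := by
      have : f (i + 1) = f i + g i + k := by simp only [hg]; ring
      rw [this, unitExp_add, unitExp_add, unitExp_int, mul_one]
    have hs := two_mul_le_sin_pi hθ (g1 i hi) (g2 i hi)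
    have := invOneSubExp_mul (x := g i) (by linarith)
    rw [e]
    linear_combination (-unitExp (f i)) * this
  -- In the summation by parts, monotonicity of `g` makes the total variation of the weights
  -- telescope.
  have key : ∀ j, j < n →
      ‖∑ i ∈ Finset.range (j + 1), unitExp (f i) + invOneSubExp (g j) * unitExp (f (j + 1))‖
        ≤ ‖invOneSubExp (g 0)‖ + (cotPi (g 0) - cotPi (g j)) / 2 := by
    intro j
    induction j with
    | zero =>
      intro _
      have := step 0 hn
      rw [Finset.sum_range_one, sub_self, zero_div, add_zero]
      have e : unitExp (f 0) + invOneSubExp (g 0) * unitExp (f (0 + 1))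
        = invOneSubExp (g 0) * unitExp (f 0) := by linear_combination this
      rw [e, norm_mul, norm_unitExp, mul_one]
    | succ j ih =>
      intro hj
      have ih' := ih (by omega)
      have e : ∑ i ∈ Finset.range (j + 1 + 1), unitExp (f i)
          + invOneSubExp (g (j + 1)) * unitExp (f (j + 1 + 1))
          = (∑ i ∈ Finset.range (j + 1), unitExp (f i) + invOneSubExp (g j) * unitExp (f (j + 1)))
            + (invOneSubExp (g (j + 1)) - invOneSubExp (g j)) * unitExp (f (j + 1)) := by
        rw [Finset.sum_range_succ _ (j + 1)]
        linear_combination step (j + 1) hj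
      have mono : cotPi (g (j + 1)) ≤ cotPi (g j) := by
        refine cotPi_antitone (hθ.trans_le (g1 j (by omega))) ?_ ?_
        · have := hm j hj
          simp only [hg]
          linarith
        · have := g2 (j + 1) hj
          linarith
      rw [e]
      refine (norm_add_le _ _).trans ?_
      rw [norm_mul, norm_unitExp, mul_one, norm_invOneSubExp_sub, abs_of_nonpos (by linarith)]
      linarith
  have hk := key (n - 1) (by omega)
  rw [Nat.sub_add_cancel hn] at hk
  have b0 := norm_invOneSubExp_le hθ (g1 0 hn) (g2 0 hn)
  have bn := norm_invOneSubExp_le hθ (g1 (n - 1) (by omega)) (g2 (n - 1) (by omega))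
  have c0 := (le_abs_self _).trans (abs_cotPi_le (g 0))
  have cn := (neg_le_abs _).trans (abs_cotPi_le (g (n - 1)))
  have tri : ‖∑ i ∈ Finset.range n, unitExp (f i)‖
      ≤ ‖∑ i ∈ Finset.range n, unitExp (f i) + invOneSubExp (g (n - 1)) * unitExp (f n)‖
        + ‖invOneSubExp (g (n - 1))‖ := by
    have := norm_sub_le
      (∑ i ∈ Finset.range n, unitExp (f i) + invOneSubExp (g (n - 1)) * unitExp (f n))
      (invOneSubExp (g (n - 1)) * unitExp (f n))
    rwa [add_sub_cancel_right, norm_mul, norm_unitExp, mul_one] at this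
  -- The two boundary weights and the two cotangent halves contribute at most `1 / (4θ)` each.
  have e : 1 / θ = 4 * (1 / (4 * θ)) := by field_simp
  rw [e]
  linarith

theorem eq_Ico_of_ordConnected (s : Finset ℕ)
    (hs : ∀ i ∈ s, ∀ j ∈ s, ∀ k, i ≤ k → k ≤ j → k ∈ s) : ∃ m n, m ≤ n ∧ s = Finset.Ico m n := by
  rcases s.eq_empty_or_nonempty with rfl | h
  · exact ⟨0, 0, le_rfl, by simp⟩
  · refine ⟨s.min' h, s.max' h + 1, (s.min'_le_max' h).trans (Nat.le_succ _), ?_⟩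
    ext k
    rw [Finset.mem_Ico, Nat.lt_succ_iff]
    exact ⟨fun hk => ⟨s.min'_le k hk, s.le_max' k hk⟩,
      fun hk => hs _ (s.min'_mem h) _ (s.max'_mem h) k hk.1 hk.2⟩

theorem card_le_of_separated (s : Finset ℕ) (g : ℕ → ℝ) {l α θ : ℝ} (hl : 0 < l) (hθ : 0 ≤ θ)
    (hs : ∀ i ∈ s, ∀ j ∈ s, i ≤ j → l * (j - i) ≤ g j - g i)
    (hα : ∀ i ∈ s, α ≤ g i ∧ g i ≤ α + θ) : (s.card : ℝ) ≤ θ / l + 1 := by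
  rcases s.eq_empty_or_nonempty with rfl | h
  · simp; positivity
  · have hsub : s ⊆ Finset.Icc (s.min' h) (s.max' h) := fun k hk =>
      Finset.mem_Icc.2 ⟨s.min'_le k hk, s.le_max' k hk⟩
    have hc := Finset.card_le_card hsub
    have hmm := s.min'_le_max' h
    rw [Nat.card_Icc] at hc
    have h1 := hs _ (s.min'_mem h) _ (s.max'_mem h) hmm
    have h2 := hα _ (s.min'_mem h)
    have h3 := hα _ (s.max'_mem h)
    have h4 : ((s.max' h : ℝ) - s.min' h) ≤ θ / l := by
      rw [le_div_iff₀ hl]; linarith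
    have h5 : (s.card : ℝ) ≤ (s.max' h : ℝ) + 1 - s.min' h := by
      rw [le_sub_iff_add_le]
      exact_mod_cast (by omega : s.card + s.min' h ≤ s.max' h + 1)
    linarith

/-- Van der Corput's bound by means of the second differences. -/
theorem norm_sum_unitExp_le_of_second_diff (f : ℕ → ℝ) (L : ℕ) {l A : ℝ} (hl : 0 < l) (hA : 1 ≤ A)
    (h1 : ∀ i, i + 1 < L → l ≤ (f (i + 2) - f (i + 1)) - (f (i + 1) - f i))
    (h2 : ∀ i, i + 1 < L → (f (i + 2) - f (i + 1)) - (f (i + 1) - f i) ≤ A * l) :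
    ‖∑ i ∈ Finset.range L, unitExp (f i)‖ ≤ (A * l * L + 2) * (4 / √l) := by
  have hsl : 0 < √l := Real.sqrt_pos.2 hl
  have hsq : √l * √l = l := Real.mul_self_sqrt hl.le
  rcases Nat.eq_zero_or_pos L with rfl | hL
  · simp only [Finset.range_zero, Finset.sum_empty, norm_zero]
    positivity
  -- For `√l > 1/2` the trivial bound `L` suffices. Otherwise `2 ≤ 1/√l`, which absorbs the rounding
  -- terms below.
  rcases lt_or_ge (1 / 2) (√l) with hbig | hsmall
  · refine (norm_sum_unitExp_le _ _).trans ?_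
    rw [Finset.card_range]
    have h : (L : ℝ) ≤ A * l * L * (4 / √l) := by
      have : A * l * L * (4 / √l) = A * L * (4 * √l) := by
        field_simp
        rw [Real.sq_sqrt hl.le]
      rw [this]
      have hLn : (0 : ℝ) ≤ L := Nat.cast_nonneg L
      nlinarith [mul_le_mul_of_nonneg_right hA hLn, mul_nonneg hLn (zero_le_one.trans hA)]
    have : 0 ≤ 2 * (4 / √l) := by positivity
    linarith
  set g : ℕ → ℝ := fun i => f (i + 1) - f i with hg
  have g1 : ∀ i, i + 1 < L → l ≤ g (i + 1) - g i := h1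
  have g2 : ∀ i, i + 1 < L → g (i + 1) - g i ≤ A * l := h2
  have gsep : ∀ i j, i ≤ j → j < L → l * ((j : ℝ) - i) ≤ g j - g i := by
    intro i j hij
    induction j, hij using Nat.le_induction with
    | base => intro _; simp
    | succ j hij ih =>
      intro hj
      have := ih (by omega)
      have := g1 j hj
      push_cast
      linarith
  have gmono : ∀ i j, i ≤ j → j < L → g i ≤ g j := by
    intro i j hij hj
    have := gsep i j hij hj
    have h' : (0 : ℝ) ≤ l * ((j : ℝ) - i) := mul_nonneg hl.le (by
      rw [sub_nonneg]; exact_mod_cast hij)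
    linarith
  have gup : ∀ j, j < L → g j - g 0 ≤ A * l * j := by
    intro j
    induction j with
    | zero => intro _; simp
    | succ j ih =>
      intro hj
      have := ih (by omega)
      have := g2 j hj
      push_cast
      linarith
  -- The indices are grouped by the integer part of the first difference `g`, which increases by at
  -- most `A l L` in all.
  set K : Finset ℤ := Finset.Icc ⌊g 0⌋ ⌊g (L - 1)⌋ with hK
  have hmaps : ∀ i ∈ Finset.range L, ⌊g i⌋ ∈ K := by
    intro i hi
    rw [Finset.mem_range] at hi
    rw [hK, Finset.mem_Icc]
    exact ⟨Int.floor_mono (gmono 0 i (Nat.zero_le _) hi),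
      Int.floor_mono (gmono i (L - 1) (by omega) (by omega))⟩
  have hKcard : (K.card : ℝ) ≤ A * l * L + 2 := by
    have hle : ⌊g 0⌋ ≤ ⌊g (L - 1)⌋ := Int.floor_mono (gmono 0 (L - 1) (Nat.zero_le _) (by omega))
    have hc : ((K.card : ℤ) : ℝ) = (⌊g (L - 1)⌋ : ℝ) + 1 - ⌊g 0⌋ := by
      rw [hK, Int.card_Icc, Int.toNat_of_nonneg (by omega)]
      push_cast
      ring
    rw [Int.cast_natCast] at hc
    have := gup (L - 1) (by omega)
    have h3 : A * l * ((L - 1 : ℕ) : ℝ) ≤ A * l * L :=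
      mul_le_mul_of_nonneg_left (by exact_mod_cast Nat.sub_le _ _) (by positivity)
    have := Int.floor_le (g (L - 1))
    have := Int.lt_floor_add_one (g 0)
    rw [hc]
    linarith
  have fiber : ∀ k ∈ K,
      ‖∑ i ∈ (Finset.range L).filter (fun i => ⌊g i⌋ = k), unitExp (f i)‖ ≤ 4 / √l := by
    intro k _
    set F := (Finset.range L).filter (fun i => ⌊g i⌋ = k) with hF
    have memF : ∀ i ∈ F, i < L ∧ (k : ℝ) ≤ g i ∧ g i < k + 1 := by
      intro i hi
      rw [hF, Finset.mem_filter, Finset.mem_range, Int.floor_eq_iff] at hi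
      exact hi
    -- Indices with `g` within `√l` of an integer are few, as `g` grows by `l` per step. The
    -- remaining ones form an interval where `kusmin_landau` applies with `θ = √l`. The choice `√l`
    -- balances the two contributions.
    set F₁ := F.filter (fun i => g i < k + √l) with hF₁
    set F₂ := F.filter (fun i => ¬ g i < k + √l) with hF₂
    set F₃ := F₂.filter (fun i => k + 1 - √l < g i) with hF₃
    set F₄ := F₂.filter (fun i => ¬ k + 1 - √l < g i) with hF₄
    have hsum : ∑ i ∈ F, unitExp (f i) = ∑ i ∈ F₁, unitExp (f i)
        + (∑ i ∈ F₃, unitExp (f i) + ∑ i ∈ F₄, unitExp (f i)) := by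
      rw [Finset.sum_filter_add_sum_filter_not, Finset.sum_filter_add_sum_filter_not]
    have c1 : (F₁.card : ℝ) ≤ √l / l + 1 := by
      refine card_le_of_separated F₁ g (α := k) hl hsl.le ?_ ?_
      · intro i _ j hj hij
        exact gsep i j hij (memF j (Finset.mem_filter.1 hj).1).1
      · intro i hi
        rw [hF₁, Finset.mem_filter] at hi
        exact ⟨(memF i hi.1).2.1, hi.2.le⟩
    have c3 : (F₃.card : ℝ) ≤ √l / l + 1 := by
      refine card_le_of_separated F₃ g (α := k + 1 - √l) hl hsl.le ?_ ?_
      · intro i _ j hj hij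
        exact gsep i j hij (memF j (Finset.mem_filter.1 (Finset.mem_filter.1 hj).1).1).1
      · intro i hi
        rw [hF₃, Finset.mem_filter, hF₂, Finset.mem_filter] at hi
        exact ⟨hi.2.le, by linarith [(memF i hi.1.1).2.2]⟩
    have mem4 : ∀ i, i ∈ F₄ ↔ i < L ∧ (k : ℝ) + √l ≤ g i ∧ g i ≤ k + 1 - √l := by
      intro i
      rw [hF₄, Finset.mem_filter, hF₂, Finset.mem_filter, hF, Finset.mem_filter, Finset.mem_range,
        Int.floor_eq_iff, not_lt, not_lt]
      constructor
      · rintro ⟨⟨⟨h, -⟩, h'⟩, h''⟩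
        exact ⟨h, h', h''⟩
      · rintro ⟨h, h', h''⟩
        exact ⟨⟨⟨h, by linarith, by linarith⟩, h'⟩, h''⟩
    have c4 : ‖∑ i ∈ F₄, unitExp (f i)‖ ≤ 1 / √l := by
      obtain ⟨m, n, hmn, h4⟩ := eq_Ico_of_ordConnected F₄ (by
        intro i hi j hj p hip hpj
        rw [mem4] at hi hj ⊢
        have hp : p < L := by omega
        exact ⟨hp, hi.2.1.trans (gmono i p hip hp), (gmono p j hpj hj.1).trans hj.2.2⟩)
      have mem : ∀ i < n - m, m + i < L ∧ (k : ℝ) + √l ≤ g (m + i) ∧ g (m + i) ≤ k + 1 - √l := by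
        intro i hi
        rw [← mem4, h4, Finset.mem_Ico]
        omega
      rw [h4, Finset.sum_Ico_eq_sum_range]
      refine kusmin_landau (fun i => f (m + i)) (n - m) k hsl ?_ ?_ ?_
      · exact fun i hi => (mem i hi).2.1
      · exact fun i hi => (mem i hi).2.2
      · intro i hi
        exact gmono (m + i) (m + (i + 1)) (by omega) (mem (i + 1) hi).1
    rw [hsum]
    have n1 := norm_sum_unitExp_le F₁ f
    have n3 := norm_sum_unitExp_le F₃ f
    have t1 := norm_add_le (∑ i ∈ F₁, unitExp (f i))
      (∑ i ∈ F₃, unitExp (f i) + ∑ i ∈ F₄, unitExp (f i))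
    have t2 := norm_add_le (∑ i ∈ F₃, unitExp (f i)) (∑ i ∈ F₄, unitExp (f i))
    have e : √l / l = 1 / √l := by
      rw [div_eq_div_iff hl.ne' hsl.ne', hsq, one_mul]
    have e2 : 2 ≤ 1 / √l := by
      rw [le_div_iff₀ hsl]; linarith
    have e3 : 4 / √l = 4 * (1 / √l) := by ring
    rw [e] at c1 c3
    rw [e3]
    linarith
  rw [← Finset.sum_fiberwise_of_maps_to hmaps]
  refine (norm_sum_le _ _).trans ((Finset.sum_le_sum fiber).trans ?_)
  rw [Finset.sum_const, nsmul_eq_mul]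
  exact mul_le_mul_of_nonneg_right hKcard (by positivity)

/-! ### The sawtooth function -/

/-- The sawtooth function `ψ(x) = {x} - 1/2`. -/
noncomputable def sawtooth (x : ℝ) : ℝ := Int.fract x - 1 / 2

/-- The periodic second Bernoulli function. -/
noncomputable def periodicBernoulli (x : ℝ) : ℝ := Int.fract x ^ 2 - Int.fract x + 6⁻¹

theorem abs_sawtooth_le (x : ℝ) : |sawtooth x| ≤ 1 / 2 := by
  have := Int.fract_nonneg x
  have := Int.fract_lt_one x
  rw [sawtooth, abs_le]
  constructor <;> linarith

theorem hasSum_periodicBernoulli (x : ℝ) :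
    HasSum (fun n : ℕ => 1 / (n : ℝ) ^ 2 * Real.cos (2 * Real.pi * (n * x)))
      (Real.pi ^ 2 * periodicBernoulli x) := by
  have h := hasSum_one_div_nat_pow_mul_cos one_ne_zero (x := Int.fract x)
    ⟨Int.fract_nonneg x, (Int.fract_lt_one x).le⟩
  have hb := bernoulliFun_two (Int.fract x)
  rw [bernoulliFun] at hb
  rw [mul_one, hb] at h
  convert! h using 1
  · funext n
    have e : 2 * Real.pi * (n * x)
        = 2 * Real.pi * n * Int.fract x + ((n * ⌊x⌋ : ℤ) : ℝ) * (2 * Real.pi) := by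
      rw [← Int.self_sub_floor]
      push_cast
      ring
    rw [e, Real.cos_add_int_mul_two_pi]
  · rw [periodicBernoulli]
    simp only [Nat.factorial]
    push_cast
    ring

theorem fract_add_cases (x : ℝ) {u : ℝ} (h0 : 0 ≤ u) (h1 : u ≤ 1) :
    Int.fract (x + u) = Int.fract x + u ∨
      (Int.fract (x + u) = Int.fract x + u - 1 ∧ 1 ≤ Int.fract x + u) := by
  have a := Int.fract_nonneg x
  have b := Int.fract_lt_one x
  have c := Int.floor_add_fract x
  rcases lt_or_ge (Int.fract x + u) 1 with h | h
  · left
    rw [Int.fract_eq_iff]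
    exact ⟨by linarith, h, ⌊x⌋, by linarith⟩
  · right
    refine ⟨?_, h⟩
    rw [Int.fract_eq_iff]
    exact ⟨by linarith, by linarith, ⌊x⌋ + 1, by push_cast; linarith⟩

/-- Subtracting `x²` from the Bernoulli function leaves a concave function, whose right slope at `x`
is `2ψ(x) - 2x`. This bound and the next are its supporting lines at `x` and at `x + u`. -/
theorem periodicBernoulli_add_sub_le (x : ℝ) {u : ℝ} (h0 : 0 ≤ u) (h1 : u ≤ 1) :
    periodicBernoulli (x + u) - periodicBernoulli x ≤ 2 * u * sawtooth x + u ^ 2 := by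
  rw [periodicBernoulli, periodicBernoulli, sawtooth]
  rcases fract_add_cases x h0 h1 with h | ⟨h, h'⟩ <;> rw [h] <;> nlinarith

theorem le_periodicBernoulli_add_sub (x : ℝ) {u : ℝ} (h0 : 0 ≤ u) (h1 : u ≤ 1) :
    2 * u * sawtooth (x + u) - u ^ 2 ≤ periodicBernoulli (x + u) - periodicBernoulli x := by
  have b := Int.fract_lt_one x
  rw [periodicBernoulli, periodicBernoulli, sawtooth]
  rcases fract_add_cases x h0 h1 with h | ⟨h, h'⟩ <;> rw [h] <;> nlinarith

/-- This interpolates between the bounds `2` and `2π|v|`. The free exponent `s` is later chosen to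
make a series converge. -/
theorem norm_unitExp_sub_one_le (v : ℝ) {s : ℝ} (h0 : 0 ≤ s) (h1 : s ≤ 1) :
    ‖unitExp v - 1‖ ≤ 7 * |v| ^ s := by
  have hv := abs_nonneg v
  rcases le_total 1 |v| with h | h
  · have : 1 ≤ |v| ^ s := Real.one_le_rpow h h0
    have t := norm_sub_le (unitExp v) 1
    rw [norm_unitExp, norm_one] at t
    linarith
  · have t := Real.norm_exp_I_mul_ofReal_sub_one_le (x := 2 * Real.pi * v)
    have e : Complex.exp (Complex.I * ((2 * Real.pi * v : ℝ) : ℂ)) = unitExp v := by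
      rw [unitExp, mul_comm]
    rw [e, Real.norm_eq_abs, abs_mul, abs_of_pos Real.two_pi_pos] at t
    have h2 : |v| ≤ |v| ^ s := by
      rcases hv.eq_or_lt with h' | h'
      · rw [← h']; exact Real.rpow_nonneg le_rfl _
      · simpa using Real.rpow_le_rpow_of_exponent_ge h' h h1
    have := Real.pi_lt_d2
    nlinarith

/-- The constant in the estimate of sawtooth sums. -/
noncomputable def sawtoothConst (ε : ℝ) : ℝ :=
  7 * (∑' n : ℕ, 1 / (n : ℝ) ^ (1 + ε)) + 7 * (∑' n : ℕ, 1 / (n : ℝ) ^ (3 / 2 : ℝ))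

theorem sawtoothConst_nonneg (ε : ℝ) : 0 ≤ sawtoothConst ε := by
  have h1 : 0 ≤ ∑' n : ℕ, 1 / (n : ℝ) ^ (1 + ε) := tsum_nonneg fun n => by positivity
  have h2 : 0 ≤ ∑' n : ℕ, 1 / (n : ℝ) ^ (3 / 2 : ℝ) := tsum_nonneg fun n => by positivity
  rw [sawtoothConst]
  linarith

/-- In the Fourier series, shifting by `u` multiplies the `n`-th exponential sum by `e(nu) - 1`.
Both signs of `u` are needed, for the upper and the lower bound on sawtooth sums. -/
theorem abs_sum_periodicBernoulli_add_sub_le (x : ℕ → ℝ) (L : ℕ) {B₁ B₂ ε : ℝ} (u : ℝ)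
    (hu : u ≠ 0) (hB₁ : 0 ≤ B₁) (hB₂ : 0 ≤ B₂) (hε : 0 < ε) (hε' : ε ≤ 1 / 2)
    (hS : ∀ h : ℕ, 1 ≤ h →
      ‖∑ i ∈ Finset.range L, unitExp (h * x i)‖ ≤ B₁ * (h : ℝ) ^ (1 / 2 : ℝ)
        + B₂ * (h : ℝ) ^ (-(1 / 2) : ℝ)) :
    |∑ i ∈ Finset.range L, (periodicBernoulli (x i + u) - periodicBernoulli (x i))|
      ≤ sawtoothConst ε * (B₁ * |u| ^ (1 / 2 - ε) + B₂ * |u|) := by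
  have hu0 : 0 < |u| := abs_pos.2 hu
  have hs := hasSum_sum (s := Finset.range L) fun i _ =>
    (hasSum_periodicBernoulli (x i + u)).sub (hasSum_periodicBernoulli (x i))
  have hz1 : Summable fun n : ℕ => 1 / (n : ℝ) ^ (1 + ε) :=
    Real.summable_one_div_nat_rpow.2 (by linarith)
  have hz2 : Summable fun n : ℕ => 1 / (n : ℝ) ^ (3 / 2 : ℝ) :=
    Real.summable_one_div_nat_rpow.2 (by norm_num)
  have hb := (hz1.hasSum.mul_left (7 * (B₁ * |u| ^ (1 / 2 - ε)))).add
    (hz2.hasSum.mul_left (7 * (B₂ * |u|)))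
  have hle := hs.norm_le_of_bounded hb (by
    intro n
    rcases Nat.eq_zero_or_pos n with rfl | hn
    -- The term `n = 0` vanishes on both sides by the convention `1 / 0 = 0`.
    · simp only [Nat.cast_zero]
      rw [Real.zero_rpow (by linarith), Real.zero_rpow (by norm_num)]
      simp
    have hn0 : (0 : ℝ) < n := by exact_mod_cast hn
    have e : ∑ i ∈ Finset.range L, (1 / (n : ℝ) ^ 2 * Real.cos (2 * Real.pi * (n * (x i + u)))
          - 1 / (n : ℝ) ^ 2 * Real.cos (2 * Real.pi * (n * x i)))
        = 1 / (n : ℝ) ^ 2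
          * ((unitExp (n * u) - 1) * ∑ i ∈ Finset.range L, unitExp (n * x i)).re := by
      rw [Finset.mul_sum, Complex.re_sum, Finset.mul_sum]
      refine Finset.sum_congr rfl fun i _ => ?_
      rw [sub_mul, one_mul, ← unitExp_add, Complex.sub_re, unitExp_re, unitExp_re, mul_sub]
      congr 4
      ring
    rw [e, norm_mul, Real.norm_eq_abs, Real.norm_eq_abs, abs_of_pos (by positivity)]
    have h1 := Complex.abs_re_le_norm
      ((unitExp (n * u) - 1) * ∑ i ∈ Finset.range L, unitExp (n * x i))
    rw [norm_mul] at h1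
    have h2 := mul_le_mul_of_nonneg_left (hS n hn) (norm_nonneg (unitExp (n * u) - 1))
    -- The exponent `1/2 - ε` leaves `n^(-1-ε)` in the `B₁` part. The exponent `1` leaves `n^(-3/2)`
    -- in the `B₂` part.
    have k1 := norm_unitExp_sub_one_le (n * u) (s := 1 / 2 - ε) (by linarith) (by linarith)
    have k2 := norm_unitExp_sub_one_le (n * u) (s := 1) (by norm_num) le_rfl
    rw [abs_mul, Nat.abs_cast] at k1 k2
    rw [Real.mul_rpow hn0.le hu0.le] at k1
    rw [Real.rpow_one] at k2
    have m1 := mul_le_mul_of_nonneg_right k1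
      (by positivity : 0 ≤ B₁ * (n : ℝ) ^ (1 / 2 : ℝ))
    have m2 := mul_le_mul_of_nonneg_right k2
      (by positivity : 0 ≤ B₂ * (n : ℝ) ^ (-(1 / 2) : ℝ))
    have n2 : (n : ℝ) ^ 2 = (n : ℝ) ^ (2 : ℝ) := by norm_cast
    have r1 : 1 / (n : ℝ) ^ 2 * ((n : ℝ) ^ (1 / 2 - ε) * (n : ℝ) ^ (1 / 2 : ℝ))
        = 1 / (n : ℝ) ^ (1 + ε) := by
      rw [n2, one_div ((n : ℝ) ^ (2 : ℝ)), one_div ((n : ℝ) ^ (1 + ε)), ← Real.rpow_neg hn0.le, ← Real.rpow_neg hn0.le,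
        ← Real.rpow_add hn0, ← Real.rpow_add hn0]
      congr 1
      ring
    have r2 : 1 / (n : ℝ) ^ 2 * ((n : ℝ) * (n : ℝ) ^ (-(1 / 2) : ℝ))
        = 1 / (n : ℝ) ^ (3 / 2 : ℝ) := by
      nth_rewrite 2 [← Real.rpow_one (n : ℝ)]
      rw [n2, one_div ((n : ℝ) ^ (2 : ℝ)), one_div ((n : ℝ) ^ (3 / 2 : ℝ)), ← Real.rpow_neg hn0.le, ← Real.rpow_neg hn0.le,
        ← Real.rpow_add hn0, ← Real.rpow_add hn0]
      congr 1
      norm_num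
    rw [← r1, ← r2]
    calc 1 / (n : ℝ) ^ 2
          * |((unitExp (n * u) - 1) * ∑ i ∈ Finset.range L, unitExp (n * x i)).re|
        ≤ 1 / (n : ℝ) ^ 2 * (7 * ((n : ℝ) ^ (1 / 2 - ε) * |u| ^ (1 / 2 - ε))
            * (B₁ * (n : ℝ) ^ (1 / 2 : ℝ))
          + 7 * (n * |u|) * (B₂ * (n : ℝ) ^ (-(1 / 2) : ℝ))) := by
          refine mul_le_mul_of_nonneg_left ?_ (by positivity)
          rw [mul_add] at h2
          linarith
      _ = _ := by ring)
  have e : ∑ i ∈ Finset.range L, (Real.pi ^ 2 * periodicBernoulli (x i + u)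
        - Real.pi ^ 2 * periodicBernoulli (x i))
      = Real.pi ^ 2
        * ∑ i ∈ Finset.range L, (periodicBernoulli (x i + u) - periodicBernoulli (x i)) := by
    rw [Finset.mul_sum]
    exact Finset.sum_congr rfl fun i _ => by ring
  rw [e, norm_mul, Real.norm_eq_abs, Real.norm_eq_abs, abs_of_pos (by positivity)] at hle
  have hpi : 1 ≤ Real.pi ^ 2 := by nlinarith [Real.pi_gt_three]
  have hab := abs_nonneg
    (∑ i ∈ Finset.range L, (periodicBernoulli (x i + u) - periodicBernoulli (x i)))
  have z1 : 0 ≤ ∑' n : ℕ, 1 / (n : ℝ) ^ (1 + ε) := tsum_nonneg fun n => by positivity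
  have z2 : 0 ≤ ∑' n : ℕ, 1 / (n : ℝ) ^ (3 / 2 : ℝ) := tsum_nonneg fun n => by positivity
  have p1 : 0 ≤ B₁ * |u| ^ (1 / 2 - ε) := by positivity
  have p2 : 0 ≤ B₂ * |u| := by positivity
  rw [sawtoothConst]
  nlinarith [mul_nonneg z1 p2, mul_nonneg z2 p1, mul_le_mul_of_nonneg_right hpi hab]

/-- The differences with steps `u` and `-u` bound `2uψ` from the two sides up to `u²`; dividing by
`u` gives the claim. -/
theorem abs_sum_sawtooth_le (x : ℕ → ℝ) (L : ℕ) {B₁ B₂ ε u : ℝ}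
    (hu : 0 < u) (hu1 : u ≤ 1) (hB₁ : 0 ≤ B₁) (hB₂ : 0 ≤ B₂) (hε : 0 < ε) (hε' : ε ≤ 1 / 2)
    (hS : ∀ h : ℕ, 1 ≤ h →
      ‖∑ i ∈ Finset.range L, unitExp (h * x i)‖ ≤ B₁ * (h : ℝ) ^ (1 / 2 : ℝ)
        + B₂ * (h : ℝ) ^ (-(1 / 2) : ℝ)) :
    |∑ i ∈ Finset.range L, sawtooth (x i)|
      ≤ L * u + sawtoothConst ε * (B₁ * u ^ (-(1 / 2) - ε) + B₂) := by
  have h1 := abs_sum_periodicBernoulli_add_sub_le x L u hu.ne' hB₁ hB₂ hε hε' hS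
  have h2 := abs_sum_periodicBernoulli_add_sub_le x L (-u) (neg_ne_zero.2 hu.ne') hB₁ hB₂ hε hε' hS
  rw [abs_neg] at h2
  rw [abs_of_pos hu] at h1 h2
  have e1 : ∑ i ∈ Finset.range L, (periodicBernoulli (x i + u) - periodicBernoulli (x i))
      ≤ 2 * u * ∑ i ∈ Finset.range L, sawtooth (x i) + L * u ^ 2 := by
    have := Finset.sum_le_sum fun i (_ : i ∈ Finset.range L) =>
      periodicBernoulli_add_sub_le (x i) hu.le hu1
    rwa [Finset.sum_add_distrib, ← Finset.mul_sum, Finset.sum_const, Finset.card_range,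
      nsmul_eq_mul] at this
  have e2 : 2 * u * ∑ i ∈ Finset.range L, sawtooth (x i) - L * u ^ 2
      ≤ -∑ i ∈ Finset.range L, (periodicBernoulli (x i + -u) - periodicBernoulli (x i)) := by
    have := Finset.sum_le_sum fun i (_ : i ∈ Finset.range L) =>
      le_periodicBernoulli_add_sub (x i - u) hu.le hu1
    simp only [sub_add_cancel] at this
    rw [Finset.sum_sub_distrib, ← Finset.mul_sum, Finset.sum_const, Finset.card_range,
      nsmul_eq_mul] at this
    rw [← Finset.sum_neg_distrib]
    refine this.trans (le_of_eq (Finset.sum_congr rfl fun i _ => ?_))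
    rw [neg_sub, sub_eq_add_neg (x i)]
  have e3 : u ^ (1 / 2 - ε) = u * u ^ (-(1 / 2) - ε) := by
    nth_rewrite 2 [← Real.rpow_one u]
    rw [← Real.rpow_add hu]
    congr 1
    ring
  rw [e3] at h1 h2
  have hc := sawtoothConst_nonneg ε
  set T := sawtoothConst ε * (B₁ * u ^ (-(1 / 2) - ε) + B₂) with hT
  have hTn : 0 ≤ T := by positivity
  have e4 : sawtoothConst ε * (B₁ * (u * u ^ (-(1 / 2) - ε)) + B₂ * u) = u * T := by
    rw [hT]; ring
  rw [e4] at h1 h2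
  have hLn : (0 : ℝ) ≤ L := Nat.cast_nonneg L
  have g1 : u * (-(L * u + T)) ≤ u * ∑ i ∈ Finset.range L, sawtooth (x i) := by
    nlinarith [neg_abs_le
      (∑ i ∈ Finset.range L, (periodicBernoulli (x i + u) - periodicBernoulli (x i))),
      mul_nonneg hLn (sq_nonneg u), mul_nonneg hu.le hTn]
  have g2 : u * ∑ i ∈ Finset.range L, sawtooth (x i) ≤ u * (L * u + T) := by
    nlinarith [neg_abs_le
      (∑ i ∈ Finset.range L, (periodicBernoulli (x i + -u) - periodicBernoulli (x i))),
      mul_nonneg hLn (sq_nonneg u), mul_nonneg hu.le hTn]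
  exact abs_le.2 ⟨le_of_mul_le_mul_left g1 hu, le_of_mul_le_mul_left g2 hu⟩

theorem norm_sum_unitExp_mul_le_of_second_diff (f : ℕ → ℝ) (L : ℕ) {l A : ℝ} (hl : 0 < l)
    (hA : 1 ≤ A)
    (h1 : ∀ i, i + 1 < L → l ≤ (f (i + 2) - f (i + 1)) - (f (i + 1) - f i))
    (h2 : ∀ i, i + 1 < L → (f (i + 2) - f (i + 1)) - (f (i + 1) - f i) ≤ A * l)
    (h : ℕ) (hh : 1 ≤ h) :
    ‖∑ i ∈ Finset.range L, unitExp (h * f i)‖ ≤ 4 * A * L * l ^ (1 / 2 : ℝ) * (h : ℝ) ^ (1 / 2 : ℝ)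
        + 8 * l ^ (-(1 / 2) : ℝ) * (h : ℝ) ^ (-(1 / 2) : ℝ) := by
  have h0 : (0 : ℝ) < h := by exact_mod_cast hh
  have k := norm_sum_unitExp_le_of_second_diff (fun i => h * f i) L (l := h * l) (A := A)
    (by positivity) hA (fun i hi => by nlinarith [h1 i hi]) (fun i hi => by nlinarith [h2 i hi])
  refine k.trans (le_of_eq ?_)
  rw [Real.sqrt_eq_rpow, Real.mul_rpow h0.le hl.le, Real.rpow_neg hl.le, Real.rpow_neg h0.le]
  have a1 : l ^ (1 / 2 : ℝ) * l ^ (1 / 2 : ℝ) = l := by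
    rw [← Real.rpow_add hl]; norm_num
  have a2 : (h : ℝ) ^ (1 / 2 : ℝ) * (h : ℝ) ^ (1 / 2 : ℝ) = h := by
    rw [← Real.rpow_add h0]; norm_num
  have b1 : 0 < l ^ (1 / 2 : ℝ) := by positivity
  have b2 : 0 < (h : ℝ) ^ (1 / 2 : ℝ) := by positivity
  generalize l ^ (1 / 2 : ℝ) = p at *
  generalize (h : ℝ) ^ (1 / 2 : ℝ) = q at *
  rw [← a1, ← a2]
  field_simp
  ring

/-- Van der Corput's bound for sums of the sawtooth function, for a sequence and its negative. -/
theorem abs_sum_sawtooth_le_of_second_diff {A ε : ℝ} (hA : 1 ≤ A) (hε : 0 < ε) (hε' : ε ≤ 1 / 2) :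
    ∃ K : ℝ, 0 < K ∧ ∀ (f : ℕ → ℝ) (L : ℕ) (l : ℝ), 0 < l → l ≤ 1 →
      (∀ i, i + 1 < L → l ≤ (f (i + 2) - f (i + 1)) - (f (i + 1) - f i)) →
      (∀ i, i + 1 < L → (f (i + 2) - f (i + 1)) - (f (i + 1) - f i) ≤ A * l) →
      |∑ i ∈ Finset.range L, sawtooth (f i)| ≤ K * (L * l ^ (1 / 3 - ε) + l ^ (-(1 / 2) : ℝ)) ∧
      |∑ i ∈ Finset.range L, sawtooth (-f i)| ≤ K * (L * l ^ (1 / 3 - ε) + l ^ (-(1 / 2) : ℝ)) := by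
  have hc := sawtoothConst_nonneg ε
  refine ⟨1 + sawtoothConst ε * (4 * A + 8), by positivity, ?_⟩
  intro f L l hl hl1 h1 h2
  have hS := norm_sum_unitExp_mul_le_of_second_diff f L hl hA h1 h2
  have hS' : ∀ h : ℕ, 1 ≤ h → ‖∑ i ∈ Finset.range L, unitExp (h * -f i)‖
      ≤ 4 * A * L * l ^ (1 / 2 : ℝ) * (h : ℝ) ^ (1 / 2 : ℝ)
        + 8 * l ^ (-(1 / 2) : ℝ) * (h : ℝ) ^ (-(1 / 2) : ℝ) := by
    intro h hh
    simp only [mul_neg, unitExp_neg]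
    rw [← map_sum, RCLike.norm_conj]
    exact hS h hh
  -- The step `u = l^(1/3)` balances `L u` against `L l^(1/2) u^(-1/2)`.
  have hu : 0 < l ^ (1 / 3 : ℝ) := by positivity
  have hu1 : l ^ (1 / 3 : ℝ) ≤ 1 := Real.rpow_le_one hl.le hl1 (by norm_num)
  have e1 : l ^ (1 / 2 : ℝ) * (l ^ (1 / 3 : ℝ)) ^ (-(1 / 2) - ε) ≤ l ^ (1 / 3 - ε) := by
    rw [← Real.rpow_mul hl.le, ← Real.rpow_add hl]
    exact Real.rpow_le_rpow_of_exponent_ge hl hl1 (by linarith)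
  have e2 : l ^ (1 / 3 : ℝ) ≤ l ^ (1 / 3 - ε) :=
    Real.rpow_le_rpow_of_exponent_ge hl hl1 (by linarith)
  have hLn : (0 : ℝ) ≤ L := Nat.cast_nonneg L
  have p : 0 < l ^ (-(1 / 2) : ℝ) := by positivity
  have fin : L * l ^ (1 / 3 : ℝ) + sawtoothConst ε * (4 * A * L * l ^ (1 / 2 : ℝ)
        * (l ^ (1 / 3 : ℝ)) ^ (-(1 / 2) - ε) + 8 * l ^ (-(1 / 2) : ℝ))
      ≤ (1 + sawtoothConst ε * (4 * A + 8)) * (L * l ^ (1 / 3 - ε) + l ^ (-(1 / 2) : ℝ)) := by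
    have q : 0 ≤ L * l ^ (1 / 3 - ε) := by positivity
    have m1 := mul_le_mul_of_nonneg_left e1 (by positivity : 0 ≤ sawtoothConst ε * (4 * A * L))
    have m2 := mul_le_mul_of_nonneg_left e2 hLn
    have m3 : 0 ≤ sawtoothConst ε * (4 * A) * l ^ (-(1 / 2) : ℝ) := by positivity
    have m4 : 0 ≤ sawtoothConst ε * 8 * (L * l ^ (1 / 3 - ε)) := by positivity
    nlinarith
  exact ⟨(abs_sum_sawtooth_le f L hu hu1 (by positivity) (by positivity) hε hε' hS).trans fin,
    (abs_sum_sawtooth_le (fun i => -f i) L hu hu1 (by positivity) (by positivity) hε hε'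
      hS').trans fin⟩

/-! ### Circular arcs -/

/-- The mean value theorem is applied to `f (t + 1) - f t`, and then to `f'`. -/
theorem second_diff_mem_of_hasDerivAt {f f' f'' : ℝ → ℝ} {a l u : ℝ}
    (hf : ∀ x ∈ Set.Icc a (a + 2), HasDerivAt f (f' x) x)
    (hf' : ∀ x ∈ Set.Icc a (a + 2), HasDerivAt f' (f'' x) x)
    (hb : ∀ x ∈ Set.Icc a (a + 2), f'' x ∈ Set.Icc l u) :
    (f (a + 2) - f (a + 1)) - (f (a + 1) - f a) ∈ Set.Icc l u := by
  have hg : ∀ x ∈ Set.Icc a (a + 1),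
      HasDerivAt (fun t => f (t + 1) - f t) (f' (x + 1) - f' x) x := fun x hx =>
    ((hf (x + 1) ⟨by linarith [hx.1], by linarith [hx.2]⟩).comp_add_const x 1).sub
      (hf x ⟨hx.1, by linarith [hx.2]⟩)
  obtain ⟨y, hy, e⟩ := exists_hasDerivAt_eq_slope (fun t => f (t + 1) - f t) _
    (by linarith : a < a + 1) (fun x hx => (hg x hx).continuousAt.continuousWithinAt)
    (fun x hx => hg x ⟨hx.1.le, hx.2.le⟩)
  have sub : ∀ x ∈ Set.Icc y (y + 1), x ∈ Set.Icc a (a + 2) := fun x hx =>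
    ⟨by linarith [hx.1, hy.1], by linarith [hx.2, hy.2]⟩
  obtain ⟨z, hz, e'⟩ := exists_hasDerivAt_eq_slope f' f'' (by linarith : y < y + 1)
    (fun x hx => (hf' x (sub x hx)).continuousAt.continuousWithinAt)
    (fun x hx => hf' x (sub x ⟨hx.1.le, hx.2.le⟩))
  have hz' := hb z (sub z ⟨hz.1.le, hz.2.le⟩)
  have e1 : a + 1 + 1 = a + 2 := by ring
  simp only [e1, add_sub_cancel_left, div_one] at e e'
  rw [← e, ← e']
  exact hz'

/-- The constants come from the 3-4-5 triangle. -/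
theorem sqrt_sub_sq_bounds {ρ x : ℝ} (hρ : 0 < ρ) (hx : |x| ≤ 4 / 5 * ρ) :
    3 / 5 * ρ ≤ √(ρ ^ 2 - x ^ 2) ∧ √(ρ ^ 2 - x ^ 2) ≤ ρ := by
  have h := sq_le_sq' (by linarith [neg_abs_le x, abs_nonneg x]) ((le_abs_self x).trans hx)
  constructor
  · apply Real.le_sqrt_of_sq_le
    nlinarith
  · rw [Real.sqrt_le_left hρ.le]
    nlinarith [sq_nonneg x]

/-- The second derivative is `ρ² / (ρ² - x²)^(3/2)`, which lies between `1/ρ` and `(5/3)³/ρ < 5/ρ`.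
-/
theorem second_diff_neg_sqrt {ρ a : ℝ} (hρ : 0 < ρ) (h1 : -(4 / 5 * ρ) ≤ a)
    (h2 : a + 2 ≤ 4 / 5 * ρ) :
    (-√(ρ ^ 2 - (a + 2) ^ 2) - -√(ρ ^ 2 - (a + 1) ^ 2))
      - (-√(ρ ^ 2 - (a + 1) ^ 2) - -√(ρ ^ 2 - a ^ 2)) ∈ Set.Icc ρ⁻¹ (5 * ρ⁻¹) := by
  have bd : ∀ x ∈ Set.Icc a (a + 2), 3 / 5 * ρ ≤ √(ρ ^ 2 - x ^ 2) ∧ √(ρ ^ 2 - x ^ 2) ≤ ρ :=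
    fun x hx => sqrt_sub_sq_bounds hρ
      (abs_le.2 ⟨by linarith [hx.1], by linarith [hx.2]⟩)
  have pos : ∀ x ∈ Set.Icc a (a + 2), 0 < √(ρ ^ 2 - x ^ 2) := fun x hx =>
    lt_of_lt_of_le (by positivity) (bd x hx).1
  have hs : ∀ x ∈ Set.Icc a (a + 2),
      HasDerivAt (fun t => √(ρ ^ 2 - t ^ 2)) (-(x / √(ρ ^ 2 - x ^ 2))) x := by
    intro x hx
    have h0 : HasDerivAt (fun t : ℝ => ρ ^ 2 - t ^ 2) (-(2 * x)) x := by
      simpa using (hasDerivAt_pow 2 x).const_sub (ρ ^ 2)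
    convert! h0.sqrt (Real.sqrt_pos.1 (pos x hx)).ne' using 1
    have := (pos x hx).ne'
    field_simp
  refine second_diff_mem_of_hasDerivAt (f := fun t => -√(ρ ^ 2 - t ^ 2))
    (f' := fun t => t / √(ρ ^ 2 - t ^ 2)) (f'' := fun t => ρ ^ 2 / √(ρ ^ 2 - t ^ 2) ^ 3) ?_ ?_ ?_
  · intro x hx
    convert! (hs x hx).neg using 1
    rw [neg_neg]
  · intro x hx
    have p := pos x hx
    convert! (hasDerivAt_id x).div (hs x hx) p.ne' using 1
    have q := Real.sq_sqrt (Real.sqrt_pos.1 p).le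
    have : ρ ^ 2 = √(ρ ^ 2 - x ^ 2) ^ 2 + x ^ 2 := by linarith
    generalize √(ρ ^ 2 - x ^ 2) = s at *
    rw [this]
    simp only [id]
    field_simp
    ring
  · intro x hx
    obtain ⟨b1, b2⟩ := bd x hx
    have p := pos x hx
    generalize √(ρ ^ 2 - x ^ 2) = s at *
    have e : ρ⁻¹ = ρ ^ 2 / ρ ^ 3 := by field_simp
    constructor
    · rw [e]
      exact div_le_div_of_nonneg_left (by positivity) (by positivity)
        (pow_le_pow_left₀ p.le b2 3)
    · have h3 := pow_le_pow_left₀ (by positivity) b1 3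
      rw [e, div_le_iff₀ (by positivity)]
      have : 5 * (ρ ^ 2 / ρ ^ 3) * (3 / 5 * ρ) ^ 3 ≤ 5 * (ρ ^ 2 / ρ ^ 3) * s ^ 3 :=
        mul_le_mul_of_nonneg_left h3 (by positivity)
      have e2 : 5 * (ρ ^ 2 / ρ ^ 3) * (3 / 5 * ρ) ^ 3 = 27 / 25 * ρ ^ 2 := by
        field_simp
        ring
      nlinarith [sq_nonneg ρ]

/-- The sawtooth sums along a circular arc. -/
theorem abs_sum_sawtooth_circle_le {ε : ℝ} (hε : 0 < ε) (hε' : ε ≤ 1 / 2) :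
    ∃ K : ℝ, 0 < K ∧ ∀ (ρ : ℝ) (M : ℤ) (L : ℕ), 1 ≤ ρ → -(4 / 5 * ρ) ≤ M → M + L ≤ 4 / 5 * ρ →
      |∑ i ∈ Finset.range L, sawtooth (√(ρ ^ 2 - ((M + i : ℤ) : ℝ) ^ 2))|
        ≤ K * (L * ρ ^ (ε - 1 / 3) + ρ ^ (1 / 2 : ℝ)) ∧
      |∑ i ∈ Finset.range L, sawtooth (-√(ρ ^ 2 - ((M + i : ℤ) : ℝ) ^ 2))|
        ≤ K * (L * ρ ^ (ε - 1 / 3) + ρ ^ (1 / 2 : ℝ)) := by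
  obtain ⟨K, hK, h⟩ := abs_sum_sawtooth_le_of_second_diff (A := 5) (by norm_num) hε hε'
  refine ⟨K, hK, ?_⟩
  intro ρ M L hρ h1 h2
  have hρ0 : 0 < ρ := by linarith
  have sd : ∀ i, i + 1 < L →
      (-√(ρ ^ 2 - ((M + (i + 2 : ℕ) : ℤ) : ℝ) ^ 2) - -√(ρ ^ 2 - ((M + (i + 1 : ℕ) : ℤ) : ℝ) ^ 2))
      - (-√(ρ ^ 2 - ((M + (i + 1 : ℕ) : ℤ) : ℝ) ^ 2) - -√(ρ ^ 2 - ((M + (i : ℕ) : ℤ) : ℝ) ^ 2))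
      ∈ Set.Icc ρ⁻¹ (5 * ρ⁻¹) := by
    intro i hi
    have hi' : (i : ℝ) + 2 ≤ L := by exact_mod_cast hi
    have := second_diff_neg_sqrt (a := M + i) hρ0
      (by have := Nat.cast_nonneg (α := ℝ) i; linarith) (by linarith)
    push_cast
    rw [← add_assoc, ← add_assoc]
    exact this
  -- The convex function is `-√`, so the two conclusions come out in the opposite order. Second
  -- differences also use the value at `M + L`, one past the summation range.
  have key := h (fun i => -√(ρ ^ 2 - ((M + i : ℤ) : ℝ) ^ 2)) L ρ⁻¹ (by positivity)
    (inv_le_one_of_one_le₀ hρ) (fun i hi => (sd i hi).1) (fun i hi => (sd i hi).2)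
  have e1 : ρ⁻¹ ^ (1 / 3 - ε) = ρ ^ (ε - 1 / 3) := by
    rw [Real.inv_rpow hρ0.le, ← Real.rpow_neg hρ0.le, neg_sub]
  have e2 : ρ⁻¹ ^ (-(1 / 2) : ℝ) = ρ ^ (1 / 2 : ℝ) := by
    rw [Real.inv_rpow hρ0.le, ← Real.rpow_neg hρ0.le, neg_neg]
  rw [e1, e2] at key
  simp only [neg_neg] at key
  exact ⟨key.2, key.1⟩

/-! ### Lattice points in vertical strips of an annulus -/

theorem norm_toPlane_sq (p : ℤ × ℤ) : ‖toPlane p‖ ^ 2 = (p.1 : ℝ) ^ 2 + (p.2 : ℝ) ^ 2 := by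
  rw [← Complex.normSq_eq_norm_sq, Complex.normSq_apply, toPlane]
  ring

/-- The lattice points above `X` in the upper part of the annulus with radii `ρ₁ ≤ ρ₂`. -/
noncomputable def strip (ρ₁ ρ₂ : ℝ) (X : Finset ℤ) : Finset (ℤ × ℤ) :=
  (X.sigma fun x => Finset.Icc ⌈√(ρ₁ ^ 2 - (x : ℝ) ^ 2)⌉ ⌊√(ρ₂ ^ 2 - (x : ℝ) ^ 2)⌋).map
    (Equiv.sigmaEquivProd ℤ ℤ).toEmbedding

theorem mem_strip {ρ₁ ρ₂ : ℝ} {X : Finset ℤ} {p : ℤ × ℤ} :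
    p ∈ strip ρ₁ ρ₂ X ↔ p.1 ∈ X ∧ √(ρ₁ ^ 2 - (p.1 : ℝ) ^ 2) ≤ p.2 ∧
      (p.2 : ℝ) ≤ √(ρ₂ ^ 2 - (p.1 : ℝ) ^ 2) := by
  rw [strip, Finset.mem_map_equiv]
  simp [Int.ceil_le, Int.le_floor]

/-- The condition `s ≤ t` forces `⌈s⌉ ≤ ⌊t⌋ + 1`, so `⌊t⌋ + 1 - ⌈s⌉` is correct for empty intervals
too. Writing `⌈s⌉ = -⌊-s⌋` avoids a separate case for integral `s`. -/
theorem card_Icc_ceil_floor {s t : ℝ} (h : s ≤ t) :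
    ((Finset.Icc ⌈s⌉ ⌊t⌋).card : ℝ) = t - s - sawtooth t - sawtooth (-s) := by
  have h1 : ⌈s⌉ ≤ ⌊t⌋ + 1 := by
    rw [Int.ceil_le]
    push_cast
    linarith [Int.lt_floor_add_one t]
  have hc : (((Finset.Icc ⌈s⌉ ⌊t⌋).card : ℤ) : ℝ) = (⌊t⌋ : ℝ) + 1 - ⌈s⌉ := by
    rw [Int.card_Icc, Int.toNat_of_nonneg (by omega)]
    push_cast
    ring
  rw [Int.cast_natCast] at hc
  rw [hc, sawtooth, sawtooth, ← Int.self_sub_floor, ← Int.self_sub_floor, Int.floor_neg]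
  push_cast
  ring

theorem card_strip {ρ₁ ρ₂ : ℝ} (h0 : 0 ≤ ρ₁) (h : ρ₁ ≤ ρ₂) (X : Finset ℤ) :
    ((strip ρ₁ ρ₂ X).card : ℝ) = ∑ x ∈ X, (√(ρ₂ ^ 2 - (x : ℝ) ^ 2) - √(ρ₁ ^ 2 - (x : ℝ) ^ 2)
      - sawtooth (√(ρ₂ ^ 2 - (x : ℝ) ^ 2)) - sawtooth (-√(ρ₁ ^ 2 - (x : ℝ) ^ 2))) := by
  rw [strip, Finset.card_map, Finset.card_sigma, Nat.cast_sum]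
  refine Finset.sum_congr rfl fun x _ => card_Icc_ceil_floor (Real.sqrt_le_sqrt ?_)
  nlinarith

theorem sum_Icc_int (M N : ℤ) (f : ℤ → ℝ) :
    ∑ x ∈ Finset.Icc M N, f x = ∑ i ∈ Finset.range (N + 1 - M).toNat, f (M + i) := by
  symm
  refine Finset.sum_bij (fun i _ => M + i) ?_ ?_ ?_ (fun _ _ => rfl)
  · intro i hi
    rw [Finset.mem_range] at hi
    rw [Finset.mem_Icc]
    omega
  · intro i _ j _ h
    omega
  · intro x hx
    rw [Finset.mem_Icc] at hx
    exact ⟨(x - M).toNat, by rw [Finset.mem_range]; omega, by omega⟩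

theorem sqrt_sub_sqrt_eq {ρ₁ ρ₂ x : ℝ} (h0 : 0 < ρ₁) (h : ρ₁ ≤ ρ₂) (hx : |x| ≤ 4 / 5 * ρ₁) :
    √(ρ₂ ^ 2 - x ^ 2) - √(ρ₁ ^ 2 - x ^ 2)
      = (ρ₂ - ρ₁) * ((ρ₁ + ρ₂) / (√(ρ₁ ^ 2 - x ^ 2) + √(ρ₂ ^ 2 - x ^ 2))) := by
  have p1 := (sqrt_sub_sq_bounds h0 hx).1
  have p2 := (sqrt_sub_sq_bounds (h0.trans_le h) (hx.trans (by linarith))).1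
  have q1 := Real.sq_sqrt (Real.sqrt_pos.1 ((by positivity : 0 < 3 / 5 * ρ₁).trans_le p1)).le
  have q2 := Real.sq_sqrt (Real.sqrt_pos.1
    ((by linarith : 0 < 3 / 5 * ρ₂).trans_le p2)).le
  rw [← mul_div_assoc, eq_div_iff (by linarith)]
  linear_combination q2 - q1

/-- A column has height at most `2 · 2`, and the two sawtooth values add at most `1`. -/
theorem card_strip_le {R ρ₁ ρ₂ : ℝ} (hR : 100 ≤ R) (h1 : R - 1 ≤ ρ₁) (h12 : ρ₁ ≤ ρ₂)
    (h2 : ρ₂ ≤ R + 1) (X : Finset ℤ) (hX : ∀ x ∈ X, |(x : ℝ)| ≤ 4 / 5 * ρ₁) :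
    (strip ρ₁ ρ₂ X).card ≤ 5 * (X.card : ℝ) := by
  rw [card_strip (by linarith) h12, mul_comm, ← nsmul_eq_mul]
  refine Finset.sum_le_card_nsmul _ _ _ fun x hx => ?_
  have p1 := (sqrt_sub_sq_bounds (by linarith) (hX x hx)).1
  have p2 := (sqrt_sub_sq_bounds (ρ := ρ₂) (by linarith) ((hX x hx).trans (by linarith))).1
  rw [sqrt_sub_sqrt_eq (by linarith) h12 (hX x hx)]
  have s1 := abs_le.1 (abs_sawtooth_le (√(ρ₂ ^ 2 - (x : ℝ) ^ 2)))
  have s2 := abs_le.1 (abs_sawtooth_le (-√(ρ₁ ^ 2 - (x : ℝ) ^ 2)))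
  have hq : (ρ₁ + ρ₂) / (√(ρ₁ ^ 2 - (x : ℝ) ^ 2) + √(ρ₂ ^ 2 - (x : ℝ) ^ 2)) ≤ 2 := by
    rw [div_le_iff₀ (by linarith)]
    linarith
  have hq0 : 0 ≤ (ρ₁ + ρ₂) / (√(ρ₁ ^ 2 - (x : ℝ) ^ 2) + √(ρ₂ ^ 2 - (x : ℝ) ^ 2)) :=
    div_nonneg (by linarith) (by positivity)
  nlinarith

/-! ### Comparison of column heights with arcs. -/

theorem hasDerivAt_arcsin_div {R x : ℝ} (hR : 0 < R) (hx : |x| ≤ 4 / 5 * R) :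
    HasDerivAt (fun t => Real.arcsin (t / R)) (1 / √(R ^ 2 - x ^ 2)) x := by
  have hx' := abs_le.1 hx
  have h1 : x / R ≠ -1 := by
    rw [Ne, div_eq_iff hR.ne']
    intro h
    linarith
  have h2 : x / R ≠ 1 := by
    rw [Ne, div_eq_iff hR.ne']
    intro h
    linarith
  have h := (Real.hasDerivAt_arcsin h1 h2).comp x ((hasDerivAt_id x).div_const R)
  convert! h using 1
  have e : 1 - (x / R) ^ 2 = (R ^ 2 - x ^ 2) / R ^ 2 := by field_simp
  rw [e, Real.sqrt_div' _ (sq_nonneg R), Real.sqrt_sq hR.le]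
  field_simp

theorem exists_arcsin_div_sub {R x y : ℝ} (hR : 0 < R) (hxy : x < y) (hx : -(4 / 5 * R) ≤ x)
    (hy : y ≤ 4 / 5 * R) :
    ∃ z ∈ Set.Ioo x y, Real.arcsin (y / R) - Real.arcsin (x / R) = (y - x) / √(R ^ 2 - z ^ 2) := by
  have hd : ∀ z ∈ Set.Icc x y,
      HasDerivAt (fun t => Real.arcsin (t / R)) (1 / √(R ^ 2 - z ^ 2)) z := fun z hz =>
    hasDerivAt_arcsin_div hR (abs_le.2 ⟨hx.trans hz.1, hz.2.trans hy⟩)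
  obtain ⟨z, hz, e⟩ := exists_hasDerivAt_eq_slope (fun t => Real.arcsin (t / R)) _ hxy
    (fun z hz => (hd z hz).continuousAt.continuousWithinAt)
    (fun z hz => hd z ⟨hz.1.le, hz.2.le⟩)
  refine ⟨z, hz, ?_⟩
  rw [eq_div_iff (sub_pos.2 hxy).ne'] at e
  rw [← e]
  ring

theorem abs_arcsin_div_sub_le {R x y : ℝ} (hR : 0 < R) (hx : |x| ≤ 4 / 5 * R)
    (hy : |y| ≤ 4 / 5 * R) :
    |Real.arcsin (y / R) - Real.arcsin (x / R)| ≤ 2 / R * |y - x| := by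
  wlog hxy : x ≤ y generalizing x y
  · rw [abs_sub_comm, abs_sub_comm y]
    exact this hy hx (le_of_not_ge hxy)
  rcases hxy.eq_or_lt with rfl | hlt
  · simp
  have hx' := abs_le.1 hx
  have hy' := abs_le.1 hy
  obtain ⟨z, hz, e⟩ := exists_arcsin_div_sub hR hlt hx'.1 hy'.2
  have b := (sqrt_sub_sq_bounds hR
    (abs_le.2 ⟨hx'.1.trans hz.1.le, hz.2.le.trans hy'.2⟩ : |z| ≤ 4 / 5 * R)).1
  rw [e, abs_div, abs_of_nonneg (Real.sqrt_nonneg _), div_eq_mul_inv, mul_comm]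
  refine mul_le_mul_of_nonneg_right ?_ (abs_nonneg _)
  rw [inv_eq_one_div, div_le_div_iff₀ (by linarith) hR]
  linarith

/-- The difference of squares is at most `4R + 1`, while `S + s` is at least `11R/10`. -/
theorem abs_sub_le_four {R ρ x z s S : ℝ} (hR : 100 ≤ R) (k1 : R - 1 ≤ ρ) (k2 : ρ ≤ R + 1)
    (zx : |z ^ 2 - x ^ 2| ≤ 2 * R) (k3 : s ^ 2 = ρ ^ 2 - x ^ 2) (k4 : S ^ 2 = R ^ 2 - z ^ 2)
    (k5 : 3 / 5 * ρ ≤ s) (k6 : 3 / 5 * R ≤ S) : |S - s| ≤ 4 := by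
  have hp : 11 / 10 * R ≤ S + s := by linarith
  have hm : |S - s| * (S + s) ≤ 4 * R + 1 := by
    rw [← abs_of_pos (by linarith : 0 < S + s), ← abs_mul]
    have : (S - s) * (S + s) = (R ^ 2 - ρ ^ 2) - (z ^ 2 - x ^ 2) := by linear_combination k4 - k3
    rw [this]
    have t : |R ^ 2 - ρ ^ 2| ≤ 2 * R + 1 := by
      rw [abs_le]; constructor <;> nlinarith
    exact (abs_sub _ _).trans (by linarith)
  by_contra hlt
  push Not at hlt
  have := mul_le_mul hlt.le hp (by linarith) (abs_nonneg _)
  linarith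

theorem abs_quotient_sub_le {R ρ₁ ρ₂ s₁ s₂ S : ℝ} (hR : 100 ≤ R) (h1 : |ρ₁ - R| ≤ 1)
    (h2 : |ρ₂ - R| ≤ 1) (n1 : |S - s₁| ≤ 4) (n2 : |S - s₂| ≤ 4) (hS : 3 / 5 * R ≤ S) (hS' : S ≤ R)
    (hs : 11 / 10 * R ≤ s₁ + s₂) :
    |(ρ₁ + ρ₂) / (s₁ + s₂) - R * (1 / S)| ≤ 20 / R := by
  have hR0 : 0 < R := by linarith
  have hS0 : 0 < S := by linarith
  have hs0 : 0 < s₁ + s₂ := by linarith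
  have p : 0 < (s₁ + s₂) * S := mul_pos hs0 hS0
  have e3 : (ρ₁ + ρ₂) / (s₁ + s₂) - R * (1 / S)
      = ((ρ₁ - R) * S + (ρ₂ - R) * S + R * (S - s₁) + R * (S - s₂)) / ((s₁ + s₂) * S) := by
    have := hs0.ne'
    have := hS0.ne'
    field_simp
    ring
  have hnum : |(ρ₁ - R) * S + (ρ₂ - R) * S + R * (S - s₁) + R * (S - s₂)| ≤ 10 * R := by
    have a1 : |(ρ₁ - R) * S| ≤ 1 * R := by
      rw [abs_mul, abs_of_pos hS0]; exact mul_le_mul h1 hS' hS0.le (by norm_num)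
    have a2 : |(ρ₂ - R) * S| ≤ 1 * R := by
      rw [abs_mul, abs_of_pos hS0]; exact mul_le_mul h2 hS' hS0.le (by norm_num)
    have a3 : |R * (S - s₁)| ≤ R * 4 := by
      rw [abs_mul, abs_of_pos hR0]; exact mul_le_mul_of_nonneg_left n1 hR0.le
    have a4 : |R * (S - s₂)| ≤ R * 4 := by
      rw [abs_mul, abs_of_pos hR0]; exact mul_le_mul_of_nonneg_left n2 hR0.le
    rw [abs_le] at *
    constructor <;> linarith
  have hden : 11 / 10 * R * (3 / 5 * R) ≤ (s₁ + s₂) * S :=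
    mul_le_mul hs hS (by positivity) hs0.le
  rw [e3, abs_div, abs_of_pos p, div_le_div_iff₀ p hR0]
  have := mul_le_mul_of_nonneg_right hnum hR0.le
  nlinarith

/-- Rationalised, the height is `(ρ₂ - ρ₁)(ρ₁ + ρ₂)/(s₁ + s₂)`. By the mean value theorem, `R` times
the arcsine increment is `R/√(R² - z²)` with `z` within `1` of `x`. The two quotients differ by
`O(1/R)`, so over `O(R)` columns the total discrepancy stays bounded. -/
theorem abs_width_sub_le {R ρ₁ ρ₂ x : ℝ} (hR : 100 ≤ R) (h1 : R - 1 ≤ ρ₁) (h12 : ρ₁ ≤ ρ₂)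
    (h2 : ρ₂ ≤ R + 1) (hx : -(7 / 9 * R) ≤ x) (hx' : x + 1 ≤ 7 / 9 * R) :
    |√(ρ₂ ^ 2 - x ^ 2) - √(ρ₁ ^ 2 - x ^ 2)
      - (ρ₂ - ρ₁) * (R * (Real.arcsin ((x + 1) / R) - Real.arcsin (x / R)))| ≤ 40 / R := by
  have hR0 : 0 < R := by linarith
  obtain ⟨z, hz, e⟩ := exists_arcsin_div_sub hR0 (by linarith : x < x + 1) (by linarith)
    (by linarith)
  have hxa : |x| ≤ 4 / 5 * ρ₁ := abs_le.2 ⟨by linarith, by linarith⟩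
  have hxa2 : |x| ≤ 4 / 5 * ρ₂ := hxa.trans (by linarith)
  have hza : |z| ≤ 4 / 5 * R := abs_le.2 ⟨by linarith [hz.1], by linarith [hz.2]⟩
  have b1 := (sqrt_sub_sq_bounds (by linarith) hxa).1
  have b2 := (sqrt_sub_sq_bounds (by linarith) hxa2).1
  have b3 := sqrt_sub_sq_bounds hR0 hza
  have q1 := Real.sq_sqrt (Real.sqrt_pos.1 ((by linarith : 0 < 3 / 5 * ρ₁).trans_le b1)).le
  have q2 := Real.sq_sqrt (Real.sqrt_pos.1 ((by linarith : 0 < 3 / 5 * ρ₂).trans_le b2)).le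
  have q3 := Real.sq_sqrt (Real.sqrt_pos.1 ((by linarith : 0 < 3 / 5 * R).trans_le b3.1)).le
  rw [sqrt_sub_sqrt_eq (by linarith) h12 hxa, e, ← mul_sub, add_sub_cancel_left, abs_mul,
    abs_of_nonneg (sub_nonneg.2 h12)]
  have zx : |z ^ 2 - x ^ 2| ≤ 2 * R := by
    have e5 : z ^ 2 - x ^ 2 = (z - x) * (z + x) := by ring
    have t1 : |z - x| ≤ 1 := abs_le.2 ⟨by linarith [hz.1], by linarith [hz.2]⟩
    have t2 : |z + x| ≤ 2 * R := abs_le.2 ⟨by linarith [hz.1], by linarith [hz.2]⟩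
    rw [e5, abs_mul]
    calc |z - x| * |z + x| ≤ 1 * (2 * R) := mul_le_mul t1 t2 (abs_nonneg _) zero_le_one
      _ = 2 * R := one_mul _
  have n1 := abs_sub_le_four hR h1 (h12.trans h2) zx q1 q3 b1 b3.1
  have n2 := abs_sub_le_four hR (h1.trans h12) h2 zx q2 q3 b2 b3.1
  have key := abs_quotient_sub_le hR (abs_le.2 ⟨by linarith, by linarith⟩ : |ρ₁ - R| ≤ 1)
    (abs_le.2 ⟨by linarith, by linarith⟩ : |ρ₂ - R| ≤ 1) n1 n2 b3.1 b3.2 (by linarith)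
  have e4 : 40 / R = 2 * (20 / R) := by ring
  rw [e4]
  exact mul_le_mul (by linarith) key (abs_nonneg _) (by norm_num)

theorem arc_error_le {R ρ ε δ : ℝ} {L : ℕ} (hε' : ε ≤ 1 / 3) (hε : 0 < ε)
    (hR : 100 ≤ R) (k1 : R - 1 ≤ ρ) (k2 : ρ ≤ R + 1) (hδ : 0 ≤ δ) (hLle : L ≤ δ + 1) :
    L * ρ ^ (ε - 1 / 3) + ρ ^ (1 / 2 : ℝ) ≤ 4 * (δ * R ^ (ε - 1 / 3) + R ^ (1 / 2 : ℝ)) := by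
  have hR0 : 0 < R := by linarith
  have hρ : 0 < ρ := by linarith
  have t1 : ρ ^ (ε - 1 / 3) ≤ 2 * R ^ (ε - 1 / 3) := by
    have a1 : ρ ^ (ε - 1 / 3) ≤ (R / 2) ^ (ε - 1 / 3) :=
      Real.rpow_le_rpow_of_nonpos (by positivity) (by linarith) (by linarith)
    have a2 : (R / 2) ^ (ε - 1 / 3) = R ^ (ε - 1 / 3) * 2 ^ (1 / 3 - ε) := by
      rw [Real.div_rpow hR0.le (by norm_num), div_eq_mul_inv, ← Real.rpow_neg (by norm_num),
        neg_sub]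
    have a3 : (2 : ℝ) ^ (1 / 3 - ε) ≤ 2 := by
      have := Real.rpow_le_rpow_of_exponent_le (x := 2) (by norm_num)
        (by linarith : 1 / 3 - ε ≤ 1)
      rwa [Real.rpow_one] at this
    rw [a2] at a1
    nlinarith [Real.rpow_pos_of_pos hR0 (ε - 1 / 3)]
  have t2 : ρ ^ (1 / 2 : ℝ) ≤ 2 * R ^ (1 / 2 : ℝ) := by
    have a1 : ρ ^ (1 / 2 : ℝ) ≤ (4 * R) ^ (1 / 2 : ℝ) :=
      Real.rpow_le_rpow hρ.le (by linarith) (by norm_num)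
    have a2 : (4 : ℝ) ^ (1 / 2 : ℝ) = 2 := by
      rw [← Real.sqrt_eq_rpow, show (4 : ℝ) = 2 ^ 2 by norm_num, Real.sqrt_sq (by norm_num)]
    rwa [Real.mul_rpow (by norm_num) hR0.le, a2] at a1
  have t3 : R ^ (ε - 1 / 3) ≤ 1 :=
    Real.rpow_le_one_of_one_le_of_nonpos (by linarith) (by linarith)
  have t4 : 1 ≤ R ^ (1 / 2 : ℝ) := Real.one_le_rpow (by linarith) (by norm_num)
  have t5 : 0 < R ^ (ε - 1 / 3) := by positivity
  have t6 : L * ρ ^ (ε - 1 / 3) ≤ (δ + 1) * (2 * R ^ (ε - 1 / 3)) :=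
    mul_le_mul hLle t1 (by positivity) (by linarith)
  nlinarith [mul_nonneg hδ t5.le]

theorem abs_sum_width_sub_le {R ρ₁ ρ₂ : ℝ} {M : ℤ} {L : ℕ} (hR : 100 ≤ R) (h1 : R - 1 ≤ ρ₁)
    (h12 : ρ₁ ≤ ρ₂) (h2 : ρ₂ ≤ R + 1) (hM : -(7 / 9 * R) ≤ M) (hL : M + L ≤ 7 / 9 * R) :
    |∑ i ∈ Finset.range L, (√(ρ₂ ^ 2 - ((M + i : ℤ) : ℝ) ^ 2)
        - √(ρ₁ ^ 2 - ((M + i : ℤ) : ℝ) ^ 2))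
      - (ρ₂ - ρ₁) * (R * (Real.arcsin ((M + L) / R) - Real.arcsin (M / R)))| ≤ 80 := by
  have hR0 : 0 < R := by linarith
  set A : ℝ → ℝ := fun x => Real.arcsin (x / R) with hA
  change |_ - (ρ₂ - ρ₁) * (R * (A (M + L) - A M))| ≤ 80
  have tel : (ρ₂ - ρ₁) * (R * (A (M + L) - A M))
      = ∑ i ∈ Finset.range L,
        (ρ₂ - ρ₁) * (R * (A (((M + i : ℤ) : ℝ) + 1) - A ((M + i : ℤ) : ℝ))) := by
    rw [← Finset.mul_sum, ← Finset.mul_sum]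
    have := Finset.sum_range_sub (fun i : ℕ => A (M + i)) L
    rw [Nat.cast_zero, add_zero] at this
    rw [← this]
    congr 2
    refine Finset.sum_congr rfl fun i _ => ?_
    push_cast
    rw [add_assoc]
  rw [tel, ← Finset.sum_sub_distrib]
  refine (Finset.abs_sum_le_sum_abs _ _).trans ?_
  have each : ∀ i ∈ Finset.range L, |√(ρ₂ ^ 2 - ((M + i : ℤ) : ℝ) ^ 2)
      - √(ρ₁ ^ 2 - ((M + i : ℤ) : ℝ) ^ 2)
      - (ρ₂ - ρ₁) * (R * (A (((M + i : ℤ) : ℝ) + 1) - A ((M + i : ℤ) : ℝ)))| ≤ 40 / R := by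
    intro i hi
    rw [Finset.mem_range] at hi
    have hi' : (i : ℝ) + 1 ≤ L := by exact_mod_cast hi
    have hi0 : (0 : ℝ) ≤ i := Nat.cast_nonneg i
    refine abs_width_sub_le hR h1 h12 h2 ?_ ?_
    · push_cast; linarith
    · push_cast; linarith
  refine (Finset.sum_le_card_nsmul _ _ _ each).trans ?_
  rw [Finset.card_range, nsmul_eq_mul, ← mul_div_assoc, div_le_iff₀ hR0]
  linarith

/-- This is the cost of rounding the endpoints `u`, `v` to integers: the arcsine term has slope at
most `2/R`. -/
theorem abs_arcsin_main_sub_le {R w u v x y : ℝ} (hR : 0 < R) (hw : 0 ≤ w) (hw2 : w ≤ 2)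
    (hu : |u| ≤ 4 / 5 * R) (hv : |v| ≤ 4 / 5 * R) (hx : |x| ≤ 4 / 5 * R) (hy : |y| ≤ 4 / 5 * R)
    (hxu : |x - u| ≤ 1) (hyv : |y - v| ≤ 1) :
    |w * (R * (Real.arcsin (y / R) - Real.arcsin (x / R)))
      - w * R * (Real.arcsin (v / R) - Real.arcsin (u / R))| ≤ 8 := by
  have e1 := (abs_arcsin_div_sub_le hR hv hy).trans
    (mul_le_of_le_one_right (by positivity) hyv)
  have e2 := (abs_arcsin_div_sub_le hR hu hx).trans
    (mul_le_of_le_one_right (by positivity) hxu)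
  have t := (abs_sub _ _).trans (add_le_add e1 e2)
  have : w * (R * (Real.arcsin (y / R) - Real.arcsin (x / R)))
        - w * R * (Real.arcsin (v / R) - Real.arcsin (u / R))
      = w * (R * ((Real.arcsin (y / R) - Real.arcsin (v / R))
        - (Real.arcsin (x / R) - Real.arcsin (u / R)))) := by ring
  rw [this, abs_mul, abs_mul, abs_of_pos hR, abs_of_nonneg hw]
  have t' := mul_le_mul_of_nonneg_left t hR.le
  have e : R * (2 / R + 2 / R) = 4 := by field_simp; norm_num
  rw [e] at t'
  calc _ ≤ 2 * 4 := mul_le_mul hw2 t' (by positivity) (by norm_num)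
    _ = 8 := by norm_num

/-- The number of points of a strip, up to the error of van der Corput's bound. -/
theorem abs_card_strip_sub_le {ε : ℝ} (hε : 0 < ε) (hε' : ε ≤ 1 / 3) :
    ∃ K : ℝ, 0 < K ∧ ∀ R ρ₁ ρ₂ u v : ℝ, 100 ≤ R → R - 1 ≤ ρ₁ → ρ₁ ≤ ρ₂ → ρ₂ ≤ R + 1 →
      -(3 / 4 * R) ≤ u → u ≤ v → v ≤ 3 / 4 * R →
      |((strip ρ₁ ρ₂ (Finset.Icc ⌈u⌉ ⌊v⌋)).card : ℝ)
          - (ρ₂ - ρ₁) * R * (Real.arcsin (v / R) - Real.arcsin (u / R))|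
        ≤ K * ((v - u) * R ^ (ε - 1 / 3) + R ^ (1 / 2 : ℝ)) := by
  obtain ⟨K, hK, hcirc⟩ := abs_sum_sawtooth_circle_le hε (hε'.trans (by norm_num))
  -- Two sawtooth sums cost `4K` each; the `80` is from the heights and the `8` from rounding the
  -- endpoints.
  refine ⟨8 * K + 88, by positivity, ?_⟩
  intro R ρ₁ ρ₂ u v hR h1 h12 h2 hu huv hv
  have hR0 : 0 < R := by linarith
  set M : ℤ := ⌈u⌉ with hM
  set L : ℕ := (⌊v⌋ + 1 - M).toNat with hL
  have hM1 : u ≤ M := Int.le_ceil u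
  have hM2 : (M : ℝ) < u + 1 := Int.ceil_lt_add_one u
  have hMN : M ≤ ⌊v⌋ + 1 := by
    rw [hM, Int.ceil_le]
    push_cast
    linarith [Int.lt_floor_add_one v]
  have hL' : (M : ℝ) + L = ⌊v⌋ + 1 := by
    have : M + (L : ℤ) = ⌊v⌋ + 1 := by omega
    exact_mod_cast this
  have hv1 := Int.floor_le v
  have hv2 := Int.lt_floor_add_one v
  have hLle : (L : ℝ) ≤ v - u + 1 := by linarith
  have hLn : (0 : ℝ) ≤ L := Nat.cast_nonneg L
  rw [card_strip (by linarith) h12, sum_Icc_int, ← hL, Finset.sum_sub_distrib,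
    Finset.sum_sub_distrib]
  have c1 := (hcirc ρ₁ M L (by linarith) (by linarith) (by linarith)).2
  have c2 := (hcirc ρ₂ M L (by linarith) (by linarith) (by linarith)).1
  have hpow : ∀ ρ : ℝ, R - 1 ≤ ρ → ρ ≤ R + 1 → _ := fun ρ k1 k2 =>
    arc_error_le hε' hε hR k1 k2 (sub_nonneg.2 huv) hLle
  have d1 := c1.trans (mul_le_mul_of_nonneg_left (hpow ρ₁ h1 (by linarith)) hK.le)
  have d2 := c2.trans (mul_le_mul_of_nonneg_left (hpow ρ₂ (by linarith) h2) hK.le)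
  have w := abs_sum_width_sub_le (M := M) (L := L) hR h1 h12 h2 (by linarith) (by linarith)
  have e3 := abs_arcsin_main_sub_le (w := ρ₂ - ρ₁) (u := u) (v := v) (x := M) (y := M + L) hR0
    (sub_nonneg.2 h12) (by linarith)
    (abs_le.2 ⟨by linarith, by linarith⟩) (abs_le.2 ⟨by linarith, by linarith⟩)
    (abs_le.2 ⟨by linarith, by linarith⟩) (abs_le.2 ⟨by linarith, by linarith⟩)
    (abs_le.2 ⟨by linarith, by linarith⟩) (abs_le.2 ⟨by linarith, by linarith⟩)
  have t4 : 1 ≤ (v - u) * R ^ (ε - 1 / 3) + R ^ (1 / 2 : ℝ) := by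
    have : 1 ≤ R ^ (1 / 2 : ℝ) := Real.one_le_rpow (by linarith) (by norm_num)
    have : 0 ≤ (v - u) * R ^ (ε - 1 / 3) := mul_nonneg (sub_nonneg.2 huv) (by positivity)
    linarith
  clear hpow c1 c2 hcirc
  generalize (v - u) * R ^ (ε - 1 / 3) + R ^ (1 / 2 : ℝ) = E at *
  have d1 := abs_le.1 d1
  have d2 := abs_le.1 d2
  have w := abs_le.1 w
  have e3 := abs_le.1 e3
  rw [abs_le]
  constructor <;> linarith

/-! ### Sectors -/

/-- The lattice points `r e^{it}` with `ρ₁ ≤ r ≤ ρ₂` and `c ≤ t ≤ d`. -/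
def closedSector (ρ₁ ρ₂ c d : ℝ) : Set (ℤ × ℤ) :=
  {p | ρ₁ ≤ ‖toPlane p‖ ∧ ‖toPlane p‖ ≤ ρ₂ ∧ ∃ t ∈ Set.Icc c d,
    (p.1 : ℝ) = ‖toPlane p‖ * Real.cos t ∧ (p.2 : ℝ) = ‖toPlane p‖ * Real.sin t}

theorem closedSector_finite (ρ₁ ρ₂ c d : ℝ) : (closedSector ρ₁ ρ₂ c d).Finite := by
  set N : ℤ := ⌈ρ₂⌉ with hN
  refine Set.Finite.subset ((Set.finite_Icc (-N) N).prod (Set.finite_Icc (-N) N)) ?_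
  rintro p ⟨-, h, -⟩
  have hc : ρ₂ ≤ (N : ℝ) := Int.le_ceil _
  have h1 : |(p.1 : ℝ)| ≤ N := (Complex.abs_re_le_norm (toPlane p)).trans (h.trans hc)
  have h2 : |(p.2 : ℝ)| ≤ N := (Complex.abs_im_le_norm (toPlane p)).trans (h.trans hc)
  rw [abs_le] at h1 h2
  exact ⟨⟨by exact_mod_cast h1.1, by exact_mod_cast h1.2⟩,
    ⟨by exact_mod_cast h2.1, by exact_mod_cast h2.2⟩⟩

theorem card_Icc_ceil_floor_le (z : ℝ) : ((Finset.Icc ⌈z - 1⌉ ⌊z + 1⌋).card : ℝ) ≤ 3 := by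
  rw [card_Icc_ceil_floor (by linarith)]
  have h1 : sawtooth (-(z - 1)) = sawtooth (-z) := by
    rw [sawtooth, sawtooth, show -(z - 1) = -z + 1 by ring, Int.fract_add_one]
  have h2 : sawtooth (z + 1) = sawtooth z := by rw [sawtooth, sawtooth, Int.fract_add_one]
  rw [h1, h2, sawtooth, sawtooth]
  have := Int.fract_nonneg z
  have := Int.fract_nonneg (-z)
  linarith

theorem cos_bounds_of_mem {t : ℝ} (h1 : Real.pi / 4 ≤ t) (h2 : t ≤ 3 * Real.pi / 4) :
    |Real.cos t| ≤ 3 / 4 ∧ 0 < Real.sin t := by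
  have hpi := Real.pi_pos
  have hs : √2 ≤ 3 / 2 := by
    rw [Real.sqrt_le_left (by norm_num)]; norm_num
  refine ⟨abs_le.2 ⟨?_, ?_⟩, Real.sin_pos_of_pos_of_lt_pi (by linarith) (by linarith)⟩
  · have := Real.cos_le_cos_of_nonneg_of_le_pi (by linarith) (by linarith) h2
    have e : Real.cos (3 * Real.pi / 4) = -(√2 / 2) := by
      rw [← Real.cos_pi_div_four, ← Real.cos_pi_sub]; congr 1; ring
    linarith
  · have := Real.cos_le_cos_of_nonneg_of_le_pi (by linarith) (by linarith) h1
    rw [Real.cos_pi_div_four] at this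
    linarith

/-- As `|r - R| ≤ 1`, the abscissa `r cos t` is within `1` of `R cos t`. Points can therefore leave
the expected columns only near `R cos c` and `R cos d`. -/
theorem closedSector_subset_strip {R ρ₁ ρ₂ c d : ℝ} (hR : 100 ≤ R) (h1 : R - 1 ≤ ρ₁)
    (h2 : ρ₂ ≤ R + 1) (hc : Real.pi / 4 ≤ c) (hd : d ≤ 3 * Real.pi / 4) :
    closedSector ρ₁ ρ₂ c d ⊆ strip ρ₁ ρ₂ (Finset.Icc ⌈R * Real.cos d⌉ ⌊R * Real.cos c⌋ ∪
      (Finset.Icc ⌈R * Real.cos c - 1⌉ ⌊R * Real.cos c + 1⌋ ∪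
        Finset.Icc ⌈R * Real.cos d - 1⌉ ⌊R * Real.cos d + 1⌋)) := by
  rintro p ⟨r1, r2, t, ht, hx, hy⟩
  have hpi := Real.pi_pos
  have hn := norm_toPlane_sq p
  set r := ‖toPlane p‖ with hr
  have ht0 : Real.pi / 4 ≤ t := hc.trans ht.1
  have ht1 : t ≤ 3 * Real.pi / 4 := ht.2.trans hd
  obtain ⟨-, bs⟩ := cos_bounds_of_mem ht0 ht1
  have k1 : Real.cos t ≤ Real.cos c :=
    Real.cos_le_cos_of_nonneg_of_le_pi (by linarith) (by linarith) ht.1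
  have k2 : Real.cos d ≤ Real.cos t :=
    Real.cos_le_cos_of_nonneg_of_le_pi (by linarith) (by linarith) ht.2
  have hy0 : (0 : ℝ) < p.2 := by rw [hy]; exact mul_pos (by linarith) bs
  have hc1 := Real.cos_le_one t
  have hc2 := Real.neg_one_le_cos t
  have x1 : (p.1 : ℝ) ≤ R * Real.cos t + 1 := by rw [hx]; nlinarith
  have x2 : R * Real.cos t - 1 ≤ (p.1 : ℝ) := by rw [hx]; nlinarith
  have m1 : R * Real.cos t ≤ R * Real.cos c := mul_le_mul_of_nonneg_left k1 (by linarith)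
  have m2 : R * Real.cos d ≤ R * Real.cos t := mul_le_mul_of_nonneg_left k2 (by linarith)
  rw [Finset.mem_coe, mem_strip]
  refine ⟨?_, ?_, ?_⟩
  · rw [Finset.mem_union, Finset.mem_union, Finset.mem_Icc, Finset.mem_Icc, Finset.mem_Icc,
      Int.ceil_le, Int.ceil_le, Int.ceil_le, Int.le_floor, Int.le_floor, Int.le_floor]
    rcases le_or_gt (p.1 : ℝ) (R * Real.cos c) with g | g
    · rcases le_or_gt (R * Real.cos d) (p.1 : ℝ) with g' | g'
      · exact Or.inl ⟨g', g⟩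
      · exact Or.inr (Or.inr ⟨by linarith, by linarith⟩)
    · exact Or.inr (Or.inl ⟨by linarith, by linarith⟩)
  · rw [Real.sqrt_le_left hy0.le]
    nlinarith
  · apply Real.le_sqrt_of_sq_le
    nlinarith

theorem exists_polar_of_pos {p : ℤ × ℤ} (hp : (0 : ℝ) < p.2) :
    ∃ t, 0 ≤ t ∧ t ≤ Real.pi ∧ (p.1 : ℝ) = ‖toPlane p‖ * Real.cos t ∧
      (p.2 : ℝ) = ‖toPlane p‖ * Real.sin t :=
  ⟨Complex.arg (toPlane p), Complex.arg_nonneg_iff.2 hp.le, Complex.arg_le_pi _,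
    (Complex.norm_mul_cos_arg (toPlane p)).symm, (Complex.norm_mul_sin_arg (toPlane p)).symm⟩

/-- If the angle `t` of a point exceeds `d`, then `r cos t ≤ r cos d ≤ R cos d + 1`, so its column
is within `1` of that end. The other end is symmetric. -/
theorem strip_subset_closedSector {R ρ₁ ρ₂ c d : ℝ} (hR : 100 ≤ R) (h1 : R - 1 ≤ ρ₁)
    (h12 : ρ₁ ≤ ρ₂) (h2 : ρ₂ ≤ R + 1)
    (hc : Real.pi / 4 ≤ c) (hcd : c ≤ d) (hd : d ≤ 3 * Real.pi / 4) :
    (strip ρ₁ ρ₂ (Finset.Icc ⌈R * Real.cos d⌉ ⌊R * Real.cos c⌋) : Set (ℤ × ℤ)) ⊆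
      closedSector ρ₁ ρ₂ c d ∪ (strip ρ₁ ρ₂
        (Finset.Icc ⌈R * Real.cos c - 1⌉ ⌊R * Real.cos c + 1⌋ ∪
          Finset.Icc ⌈R * Real.cos d - 1⌉ ⌊R * Real.cos d + 1⌋) : Set (ℤ × ℤ)) := by
  intro p hp
  have hpi := Real.pi_pos
  rw [Finset.mem_coe, mem_strip, Finset.mem_Icc, Int.ceil_le, Int.le_floor] at hp
  obtain ⟨⟨x1, x2⟩, y1, y2⟩ := hp
  obtain ⟨bc, -⟩ := cos_bounds_of_mem hc (hcd.trans hd)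
  obtain ⟨bd, -⟩ := cos_bounds_of_mem (hc.trans hcd) hd
  rw [abs_le] at bc bd
  have bd' := mul_le_mul_of_nonneg_left bd.1 (by linarith : 0 ≤ R)
  have bc' := mul_le_mul_of_nonneg_left bc.2 (by linarith : 0 ≤ R)
  have xa : |(p.1 : ℝ)| ≤ 4 / 5 * ρ₁ := abs_le.2 ⟨by linarith, by linarith⟩
  have b1 := (sqrt_sub_sq_bounds (by linarith) xa).1
  have b2 := (sqrt_sub_sq_bounds (ρ := ρ₂) (by linarith) (xa.trans (by linarith))).1
  have q1 := Real.sq_sqrt (Real.sqrt_pos.1 ((by linarith : 0 < 3 / 5 * ρ₁).trans_le b1)).le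
  have q2 := Real.sq_sqrt (Real.sqrt_pos.1 ((by linarith : 0 < 3 / 5 * ρ₂).trans_le b2)).le
  have hn := norm_toPlane_sq p
  have y0 : (0 : ℝ) < p.2 := by linarith
  have s1 := pow_le_pow_left₀ (Real.sqrt_nonneg _) y1 2
  have s2 := pow_le_pow_left₀ y0.le y2 2
  have r1 : ρ₁ ≤ ‖toPlane p‖ := by
    apply le_of_sq_le_sq _ (norm_nonneg _)
    linarith
  have r2 : ‖toPlane p‖ ≤ ρ₂ := by
    apply le_of_sq_le_sq _ (by linarith)
    linarith
  set r := ‖toPlane p‖ with hr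
  have r0 : 0 < r := by linarith
  obtain ⟨t, ht0, ht1, ct', st⟩ := exists_polar_of_pos y0
  rw [← hr] at ct' st
  have near : ∀ x : ℝ, |(r - R) * Real.cos x| ≤ 1 := fun x => by
    rw [abs_mul]
    exact mul_le_one₀ (abs_le.2 ⟨by linarith, by linarith⟩) (abs_nonneg _) (Real.abs_cos_le_one x)
  have nc := abs_le.1 (near c)
  have nd := abs_le.1 (near d)
  by_cases htc : c ≤ t
  · by_cases htd : t ≤ d
    · exact Or.inl ⟨r1, r2, t, ⟨htc, htd⟩, ct', st⟩
    · right
      push Not at htd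
      have k : Real.cos t ≤ Real.cos d :=
        Real.cos_le_cos_of_nonneg_of_le_pi (by linarith) ht1 htd.le
      rw [Finset.mem_coe, mem_strip, Finset.mem_union]
      refine ⟨Or.inr ?_, y1, y2⟩
      rw [Finset.mem_Icc, Int.ceil_le, Int.le_floor]
      have k2 := mul_le_mul_of_nonneg_left k r0.le
      exact ⟨by linarith, by linarith⟩
  · right
    push Not at htc
    have k : Real.cos c ≤ Real.cos t :=
      Real.cos_le_cos_of_nonneg_of_le_pi ht0 (by linarith) htc.le
    rw [Finset.mem_coe, mem_strip, Finset.mem_union]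
    refine ⟨Or.inl ?_, y1, y2⟩
    rw [Finset.mem_Icc, Int.ceil_le, Int.le_floor]
    have k2 := mul_le_mul_of_nonneg_left k r0.le
    exact ⟨by linarith, by linarith⟩

/-- The count of the points of a sector inside the quadrant `π/4 ≤ t ≤ 3π/4`. -/
theorem abs_ncard_closedSector_sub_le_of_quadrant {ε : ℝ} (hε : 0 < ε) (hε' : ε ≤ 1 / 3) :
    ∃ K : ℝ, 0 < K ∧ ∀ R ρ₁ ρ₂ c d : ℝ, 100 ≤ R → R - 1 ≤ ρ₁ → ρ₁ ≤ ρ₂ → ρ₂ ≤ R + 1 →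
      Real.pi / 4 ≤ c → c ≤ d → d ≤ 3 * Real.pi / 4 →
      |((closedSector ρ₁ ρ₂ c d).ncard : ℝ) - (ρ₂ - ρ₁) * R * (d - c)|
        ≤ K * ((d - c) * R ^ (2 / 3 + ε) + R ^ (1 / 2 : ℝ)) := by
  obtain ⟨K, hK, hstrip⟩ := abs_card_strip_sub_le hε hε'
  refine ⟨K + 30, by positivity, ?_⟩
  intro R ρ₁ ρ₂ c d hR h1 h12 h2 hc hcd hd
  have hR0 : 0 < R := by linarith
  have hpi := Real.pi_pos
  have bc := abs_le.1 (cos_bounds_of_mem hc (hcd.trans hd)).1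
  have bd := abs_le.1 (cos_bounds_of_mem (hc.trans hcd) hd).1
  have bc1 := mul_le_mul_of_nonneg_left bc.1 hR0.le
  have bc2 := mul_le_mul_of_nonneg_left bc.2 hR0.le
  have bd1 := mul_le_mul_of_nonneg_left bd.1 hR0.le
  have bd2 := mul_le_mul_of_nonneg_left bd.2 hR0.le
  have hcos : Real.cos d ≤ Real.cos c :=
    Real.cos_le_cos_of_nonneg_of_le_pi (by linarith) (by linarith) hcd
  have huv := mul_le_mul_of_nonneg_left hcos hR0.le
  have key := hstrip R ρ₁ ρ₂ (R * Real.cos d) (R * Real.cos c) hR h1 h12 h2 (by linarith) huv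
    (by linarith)
  -- With `arcsin (cos t) = π/2 - t`, the main term becomes proportional to `d - c`.
  have arc : ∀ t, Real.pi / 4 ≤ t → t ≤ 3 * Real.pi / 4 →
      Real.arcsin (R * Real.cos t / R) = Real.pi / 2 - t := by
    intro t ht ht'
    rw [mul_div_cancel_left₀ _ hR0.ne', ← Real.sin_pi_div_two_sub,
      Real.arcsin_sin (by linarith) (by linarith)]
  rw [arc c hc (hcd.trans hd), arc d (hc.trans hcd) hd] at key
  set X := Finset.Icc ⌈R * Real.cos d⌉ ⌊R * Real.cos c⌋ with hX
  set Y := Finset.Icc ⌈R * Real.cos c - 1⌉ ⌊R * Real.cos c + 1⌋ ∪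
        Finset.Icc ⌈R * Real.cos d - 1⌉ ⌊R * Real.cos d + 1⌋ with hY
  -- There are at most `3 + 3` exceptional columns, with at most `5` points each.
  have cY : ((strip ρ₁ ρ₂ Y).card : ℝ) ≤ 30 := by
    have h : ∀ x ∈ Y, |(x : ℝ)| ≤ 4 / 5 * ρ₁ := by
      intro x hx
      rw [hY, Finset.mem_union, Finset.mem_Icc, Finset.mem_Icc, Int.ceil_le, Int.ceil_le,
        Int.le_floor, Int.le_floor] at hx
      rw [abs_le]
      rcases hx with hx | hx <;> constructor <;> linarith [hx.1, hx.2]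
    have c1 := card_Icc_ceil_floor_le (R * Real.cos c)
    have c2 := card_Icc_ceil_floor_le (R * Real.cos d)
    have c3 : (Y.card : ℝ) ≤ ((Finset.Icc ⌈R * Real.cos c - 1⌉ ⌊R * Real.cos c + 1⌋).card : ℝ)
        + (Finset.Icc ⌈R * Real.cos d - 1⌉ ⌊R * Real.cos d + 1⌋).card := by
      exact_mod_cast Finset.card_union_le _ _
    have := card_strip_le hR h1 h12 h2 Y h
    linarith
  have up : ((closedSector ρ₁ ρ₂ c d).ncard : ℝ)
      ≤ (strip ρ₁ ρ₂ X).card + (strip ρ₁ ρ₂ Y).card := by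
    have sub : closedSector ρ₁ ρ₂ c d
        ⊆ (strip ρ₁ ρ₂ X : Set (ℤ × ℤ)) ∪ (strip ρ₁ ρ₂ Y : Set (ℤ × ℤ)) := by
      intro p hp
      have := closedSector_subset_strip hR h1 h2 hc hd hp
      rw [Finset.mem_coe, mem_strip, Finset.mem_union] at this
      rw [Set.mem_union, Finset.mem_coe, Finset.mem_coe, mem_strip, mem_strip]
      rcases this with ⟨h | h, h'⟩
      · exact Or.inl ⟨h, h'⟩
      · exact Or.inr ⟨h, h'⟩
    have := (Set.ncard_le_ncard sub ((Finset.finite_toSet _).union (Finset.finite_toSet _))).trans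
      (Set.ncard_union_le _ _)
    rw [Set.ncard_coe_finset, Set.ncard_coe_finset] at this
    exact_mod_cast this
  have low : ((strip ρ₁ ρ₂ X).card : ℝ)
      ≤ (closedSector ρ₁ ρ₂ c d).ncard + (strip ρ₁ ρ₂ Y).card := by
    have := (Set.ncard_le_ncard (strip_subset_closedSector hR h1 h12 h2 hc hcd hd)
      ((closedSector_finite _ _ _ _).union (Finset.finite_toSet _))).trans
      (Set.ncard_union_le _ _)
    rw [Set.ncard_coe_finset, Set.ncard_coe_finset] at this
    exact_mod_cast this
  have t4 : 1 ≤ R ^ (1 / 2 : ℝ) := Real.one_le_rpow (by linarith) (by norm_num)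
  have hlip : Real.cos c - Real.cos d ≤ d - c := by
    have := Real.abs_cos_sub_cos_le c d
    rw [abs_sub_comm c d, abs_of_nonneg (sub_nonneg.2 hcd)] at this
    exact (le_abs_self _).trans this
  have hE : (R * Real.cos c - R * Real.cos d) * R ^ (ε - 1 / 3) ≤ (d - c) * R ^ (2 / 3 + ε) := by
    have e : R ^ (2 / 3 + ε) = R * R ^ (ε - 1 / 3) := by
      nth_rewrite 2 [← Real.rpow_one R]
      rw [← Real.rpow_add hR0]
      congr 1
      ring
    rw [e, ← mul_sub, mul_comm R, mul_assoc]
    exact mul_le_mul_of_nonneg_right hlip (by positivity)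
  have hE0 : 0 ≤ (d - c) * R ^ (2 / 3 + ε) := mul_nonneg (sub_nonneg.2 hcd) (by positivity)
  have key' := key.trans (mul_le_mul_of_nonneg_left (add_le_add_left hE _) hK.le)
  have e : Real.pi / 2 - c - (Real.pi / 2 - d) = d - c := by ring
  rw [e] at key'
  have key2 := abs_le.1 key'
  rw [abs_le]
  constructor <;> linarith

/-! ### Quarter turns and the gluing of quadrants. -/

theorem toPlane_rotate_norm (p : ℤ × ℤ) : ‖toPlane (-p.2, p.1)‖ = ‖toPlane p‖ := by
  rw [← sq_eq_sq₀ (norm_nonneg _) (norm_nonneg _), norm_toPlane_sq, norm_toPlane_sq]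
  push_cast
  ring

theorem closedSector_rotate (ρ₁ ρ₂ c d : ℝ) :
    closedSector ρ₁ ρ₂ (c + Real.pi / 2) (d + Real.pi / 2)
      = (fun p : ℤ × ℤ => (-p.2, p.1)) '' closedSector ρ₁ ρ₂ c d := by
  ext p
  constructor
  · rintro ⟨r1, r2, t, ht, hx, hy⟩
    have e : ((-(-p.1), p.2) : ℤ × ℤ) = p := by rw [neg_neg]
    have hn : ‖toPlane (p.2, -p.1)‖ = ‖toPlane p‖ := by
      rw [← toPlane_rotate_norm (p.2, -p.1), e]
    refine ⟨(p.2, -p.1), ⟨by rwa [hn], by rwa [hn], t - Real.pi / 2,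
      ⟨by linarith [ht.1], by linarith [ht.2]⟩, ?_, ?_⟩, e⟩
    · rw [hn, Real.cos_sub_pi_div_two]; exact hy
    · rw [hn, Real.sin_sub_pi_div_two]; push_cast; linarith
  · rintro ⟨p, ⟨r1, r2, t, ht, hx, hy⟩, rfl⟩
    have hn := toPlane_rotate_norm p
    refine ⟨by rwa [hn], by rwa [hn], t + Real.pi / 2,
      ⟨by linarith [ht.1], by linarith [ht.2]⟩, ?_, ?_⟩
    · rw [hn, Real.cos_add_pi_div_two]; push_cast; linarith
    · rw [hn, Real.sin_add_pi_div_two]; exact hx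

theorem ncard_closedSector_rotate (ρ₁ ρ₂ c d : ℝ) (k : ℤ) :
    (closedSector ρ₁ ρ₂ (c + k * (Real.pi / 2)) (d + k * (Real.pi / 2))).ncard
      = (closedSector ρ₁ ρ₂ c d).ncard := by
  have hper : Function.Periodic (fun s => (closedSector ρ₁ ρ₂ (c + s) (d + s)).ncard)
      (Real.pi / 2) := by
    intro s
    simp only
    rw [← add_assoc, ← add_assoc, closedSector_rotate]
    refine Set.ncard_image_of_injective _ fun p q h => ?_
    simp only [Prod.mk.injEq, neg_inj] at h
    exact Prod.ext h.2 h.1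
  have := hper.int_mul k 0
  simpa using this

/-- Distinct lattice points on one ray are at least `1` apart, so the integer part of `‖p‖ - ρ₁`
separates them. -/
theorem ncard_closedSector_self_le {ρ₁ ρ₂ : ℝ} (h : ρ₂ ≤ ρ₁ + 2) (m : ℝ) :
    (closedSector ρ₁ ρ₂ m m).ncard ≤ 3 := by
  have hc : (Set.Icc (0 : ℤ) 2).ncard = 3 := by
    rw [← Finset.coe_Icc, Set.ncard_coe_finset]
    rfl
  rw [← hc]
  refine Set.ncard_le_ncard_of_injOn (fun p => ⌊‖toPlane p‖ - ρ₁⌋) ?_ ?_ (Set.finite_Icc _ _)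
  · rintro p ⟨r1, r2, -⟩
    refine ⟨Int.floor_nonneg.2 (by linarith), ?_⟩
    have := Int.floor_mono (by linarith : ‖toPlane p‖ - ρ₁ ≤ 2)
    simpa using this
  · rintro p ⟨-, -, t, ht, hx, hy⟩ q ⟨-, -, u, hu, hx', hy'⟩ hpq
    rw [Set.Icc_self, Set.mem_singleton_iff] at ht hu
    subst ht
    subst hu
    have hlt := abs_lt.1 (Int.abs_sub_lt_one_of_floor_eq_floor hpq)
    have hsq : (‖toPlane p‖ - ‖toPlane q‖) ^ 2 < 1 := by
      rw [sq_lt_one_iff_abs_lt_one, abs_lt]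
      constructor <;> linarith [hlt.1, hlt.2]
    have key : ((p.1 : ℝ) - q.1) ^ 2 + ((p.2 : ℝ) - q.2) ^ 2 < 1 := by
      have := Real.sin_sq_add_cos_sq u
      rw [hx, hy, hx', hy']
      calc _ = (‖toPlane p‖ - ‖toPlane q‖) ^ 2 * (Real.sin u ^ 2 + Real.cos u ^ 2) := by ring
        _ < 1 := by rw [this, mul_one]; exact hsq
    have z : ∀ i j : ℤ, ((i : ℝ) - j) ^ 2 < 1 → i = j := by
      intro i j hij
      have h1 : (i - j) ^ 2 < 1 := by exact_mod_cast hij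
      have := (sq_lt_one_iff_abs_lt_one _).1 h1
      rw [Int.abs_lt_one_iff] at this
      omega
    exact Prod.ext (z _ _ (by nlinarith [sq_nonneg ((p.2 : ℝ) - q.2)]))
      (z _ _ (by nlinarith [sq_nonneg ((p.1 : ℝ) - q.1)]))

theorem cos_sub_eq_one_of_polar {r t u x y : ℝ} (hr : 0 < r) (h1 : x = r * Real.cos t)
    (h2 : y = r * Real.sin t) (h3 : x = r * Real.cos u) (h4 : y = r * Real.sin u) :
    Real.cos (t - u) = 1 := by
  have e1 : Real.cos t = Real.cos u := mul_left_cancel₀ hr.ne' (h1.symm.trans h3)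
  have e2 : Real.sin t = Real.sin u := mul_left_cancel₀ hr.ne' (h2.symm.trans h4)
  rw [Real.cos_sub, e1, e2, ← sq, ← sq, Real.cos_sq_add_sin_sq]

/-- The two parts share the ray `m` and, when `d - c = 2π`, also the ray `c`; each ray holds at most
three points. -/
theorem abs_ncard_closedSector_split {ρ₁ ρ₂ c m d : ℝ} (h0 : 0 < ρ₁) (h : ρ₂ ≤ ρ₁ + 2)
    (hcm : c ≤ m) (hmd : m ≤ d) (hd : d - c ≤ 2 * Real.pi) :
    |((closedSector ρ₁ ρ₂ c d).ncard : ℝ)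
      - ((closedSector ρ₁ ρ₂ c m).ncard + (closedSector ρ₁ ρ₂ m d).ncard)| ≤ 6 := by
  have hu : closedSector ρ₁ ρ₂ c d = closedSector ρ₁ ρ₂ c m ∪ closedSector ρ₁ ρ₂ m d := by
    ext p
    constructor
    · rintro ⟨r1, r2, t, ht, hp⟩
      rcases le_total t m with htm | htm
      · exact Or.inl ⟨r1, r2, t, ⟨ht.1, htm⟩, hp⟩
      · exact Or.inr ⟨r1, r2, t, ⟨htm, ht.2⟩, hp⟩
    · rintro (⟨r1, r2, t, ht, hp⟩ | ⟨r1, r2, t, ht, hp⟩)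
      · exact ⟨r1, r2, t, ⟨ht.1, ht.2.trans hmd⟩, hp⟩
      · exact ⟨r1, r2, t, ⟨hcm.trans ht.1, ht.2⟩, hp⟩
  have hi : closedSector ρ₁ ρ₂ c m ∩ closedSector ρ₁ ρ₂ m d
      ⊆ closedSector ρ₁ ρ₂ m m ∪ closedSector ρ₁ ρ₂ c c := by
    rintro p ⟨⟨r1, r2, t, ht, hp⟩, ⟨-, -, u, hu, hq⟩⟩
    have hcos := cos_sub_eq_one_of_polar (h0.trans_le r1) hq.1 hq.2 hp.1 hp.2
    have hpi := Real.pi_pos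
    rcases lt_or_ge (u - t) (2 * Real.pi) with hlt | hge
    · have := (Real.cos_eq_one_iff_of_lt_of_lt (by linarith [ht.2, hu.1]) hlt).1 hcos
      have e : t = m := le_antisymm ht.2 (by linarith [hu.1])
      exact Or.inl ⟨r1, r2, m, ⟨le_rfl, le_rfl⟩, e ▸ hp⟩
    · have e : t = c := le_antisymm (by linarith [hu.2]) ht.1
      exact Or.inr ⟨r1, r2, c, ⟨le_rfl, le_rfl⟩, e ▸ hp⟩
  have c1 := (Set.ncard_le_ncard hi ((closedSector_finite _ _ _ _).union
    (closedSector_finite _ _ _ _))).trans (Set.ncard_union_le _ _)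
  have c2 := ncard_closedSector_self_le h m
  have c3 := ncard_closedSector_self_le h c
  have c4 := Set.ncard_union_add_ncard_inter (closedSector ρ₁ ρ₂ c m) (closedSector ρ₁ ρ₂ m d)
    (closedSector_finite _ _ _ _) (closedSector_finite _ _ _ _)
  rw [← hu] at c4
  have c5 : (((closedSector ρ₁ ρ₂ c m ∩ closedSector ρ₁ ρ₂ m d).ncard : ℕ) : ℝ) ≤ 6 := by
    exact_mod_cast (by omega : (closedSector ρ₁ ρ₂ c m ∩ closedSector ρ₁ ρ₂ m d).ncard ≤ 6)
  have c6 : ((closedSector ρ₁ ρ₂ c d).ncard : ℝ)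
      + (closedSector ρ₁ ρ₂ c m ∩ closedSector ρ₁ ρ₂ m d).ncard
      = (closedSector ρ₁ ρ₂ c m).ncard + (closedSector ρ₁ ρ₂ m d).ncard := by
    exact_mod_cast c4
  have c7 := Nat.cast_nonneg (α := ℝ) (closedSector ρ₁ ρ₂ c m ∩ closedSector ρ₁ ρ₂ m d).ncard
  rw [abs_le]
  constructor <;> linarith

/-- This is induction on the number of cells `[q k, q (k+1)]` met. The fixed interval `[c₀, d₀]`
lets one bound `E` serve every piece. -/
theorem abs_ncard_closedSector_sub_le_of_pieces {ρ₁ ρ₂ A E : ℝ} (h0 : 0 < ρ₁) (h : ρ₂ ≤ ρ₁ + 2)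
    (hE0 : 0 ≤ E)    (q : ℤ → ℝ) (c₀ d₀ : ℝ) (hcd₀ : d₀ - c₀ ≤ 2 * Real.pi)
    (hE : ∀ k : ℤ, ∀ c d : ℝ, c₀ ≤ c → d ≤ d₀ → q k ≤ c → c ≤ d → d ≤ q (k + 1) →
      |((closedSector ρ₁ ρ₂ c d).ncard : ℝ) - A * (d - c)| ≤ E) (k : ℤ) (n : ℕ) :
    ∀ c d : ℝ, c₀ ≤ c → d ≤ d₀ → q k ≤ c → c ≤ d → d ≤ q (k + 1 + n) →
      |((closedSector ρ₁ ρ₂ c d).ncard : ℝ) - A * (d - c)| ≤ (n + 1) * (E + 6) := by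
  induction n with
  | zero =>
    intro c d hc hd h1 h2 h3
    have := hE k c d hc hd h1 h2 (by simpa using h3)
    push_cast
    linarith
  | succ n ih =>
    intro c d hc hd h1 h2 h3
    set m := q (k + 1 + n) with hm
    have e : k + 1 + ((n + 1 : ℕ) : ℤ) = k + 1 + n + 1 := by push_cast; ring
    rw [e] at h3
    have hnE : 0 ≤ (n + 1 : ℝ) * (E + 6) := by positivity
    have big : (((n + 1 : ℕ) : ℝ) + 1) * (E + 6) = (n + 1) * (E + 6) + (E + 6) := by
      push_cast; ring
    rw [big]
    rcases le_or_gt d m with hdm | hmd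
    · have := ih c d hc hd h1 h2 hdm
      linarith
    rcases le_or_gt m c with hmc | hcm
    · have := hE (k + 1 + n) c d hc hd hmc h2 h3
      linarith
    · have i1 := abs_le.1 (ih c m hc (by linarith) h1 hcm.le le_rfl)
      have i2 := abs_le.1 (hE (k + 1 + n) m d (by linarith) hd le_rfl hmd.le h3)
      have i3 := abs_le.1 (abs_ncard_closedSector_split h0 h hcm.le hmd.le
        (by linarith : d - c ≤ 2 * Real.pi))
      rw [abs_le]
      constructor <;> linarith

/-- The count of the points of a closed sector. -/
theorem abs_ncard_closedSector_sub_le {ε : ℝ} (hε : 0 < ε) (hε' : ε ≤ 1 / 3) :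
    ∃ K : ℝ, 0 < K ∧ ∀ R ρ₁ ρ₂ c d : ℝ, 100 ≤ R → R - 1 ≤ ρ₁ → ρ₁ ≤ ρ₂ → ρ₂ ≤ R + 1 →
      c ≤ d → d - c ≤ 2 * Real.pi →
      |((closedSector ρ₁ ρ₂ c d).ncard : ℝ) - (ρ₂ - ρ₁) * R * (d - c)|
        ≤ K * ((d - c) * R ^ (2 / 3 + ε) + R ^ (1 / 2 : ℝ)) := by
  obtain ⟨K, hK, hquad⟩ := abs_ncard_closedSector_sub_le_of_quadrant hε hε'
  refine ⟨5 * (K + 6), by positivity, ?_⟩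
  intro R ρ₁ ρ₂ c d hR h1 h12 h2 hcd hd
  have hR0 : 0 < R := by linarith
  have hpi := Real.pi_pos
  set T : ℝ := (d - c) * R ^ (2 / 3 + ε) + R ^ (1 / 2 : ℝ) with hT
  have hT1 : 1 ≤ T := by
    have t1 : 1 ≤ R ^ (1 / 2 : ℝ) := Real.one_le_rpow (by linarith) (by norm_num)
    have t2 : 0 ≤ (d - c) * R ^ (2 / 3 + ε) := mul_nonneg (sub_nonneg.2 hcd) (by positivity)
    linarith
  set q : ℤ → ℝ := fun k => Real.pi / 4 + k * (Real.pi / 2) with hq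
  -- If `c` lies in the `k`-th quadrant, then `d ≤ c + 2π` lies below `q (k + 5)`, so five quadrants
  -- suffice.
  have pieces := abs_ncard_closedSector_sub_le_of_pieces (ρ₁ := ρ₁) (ρ₂ := ρ₂)
    (A := (ρ₂ - ρ₁) * R) (E := K * T) (by linarith) (by linarith) (by positivity) q c d hd ?_
    ⌊(c - Real.pi / 4) / (Real.pi / 2)⌋ 4 c d le_rfl le_rfl ?_ hcd ?_
  · refine pieces.trans ?_
    push_cast
    nlinarith
  · intro k x y hx hy h3 hxy h4
    simp only [hq] at h3 h4
    push_cast at h4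
    rw [← ncard_closedSector_rotate ρ₁ ρ₂ x y (-k)]
    have := hquad R ρ₁ ρ₂ (x + (-k : ℤ) * (Real.pi / 2)) (y + (-k : ℤ) * (Real.pi / 2)) hR h1 h12 h2
      (by push_cast; linarith) (by linarith) (by push_cast; linarith)
    rw [add_sub_add_right_eq_sub] at this
    refine this.trans (mul_le_mul_of_nonneg_left ?_ hK.le)
    rw [hT]
    have hp : 0 < R ^ (2 / 3 + ε) := by positivity
    have := mul_le_mul_of_nonneg_right (by linarith : y - x ≤ d - c) hp.le
    linarith
  · have := Int.floor_le ((c - Real.pi / 4) / (Real.pi / 2))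
    rw [le_div_iff₀ (by positivity)] at this
    simp only [hq]
    linarith
  · have := Int.lt_floor_add_one ((c - Real.pi / 4) / (Real.pi / 2))
    rw [div_lt_iff₀ (by positivity)] at this
    simp only [hq]
    push_cast
    linarith

/-! ### The sectors of the annulus `Γ_R` -/

theorem eq_norm_mul_cos_angle (p : ℤ × ℤ) :
    (p.1 : ℝ) = ‖toPlane p‖ * Real.cos (angle p) ∧
      (p.2 : ℝ) = ‖toPlane p‖ * Real.sin (angle p) := by
  have h := polar_eq 0 p
  rw [radial, sub_zero, zero_add] at h
  have e1 := congrArg Complex.re h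
  have e2 := congrArg Complex.im h
  rw [Complex.re_ofReal_mul, Complex.exp_ofReal_mul_I_re] at e1
  rw [Complex.im_ofReal_mul, Complex.exp_ofReal_mul_I_im] at e2
  exact ⟨e1, e2⟩

theorem sectorPoints_subset (R c d a b : ℝ) :
    sectorPoints R c d a b ⊆ closedSector (R + a) (R + b) c d := by
  rintro p ⟨-, ⟨k, hk⟩, hr⟩
  rw [radial] at hr
  obtain ⟨h1, h2⟩ := eq_norm_mul_cos_angle p
  refine ⟨by linarith [hr.1], by linarith [hr.2], _, hk, ?_, ?_⟩
  · rw [mul_comm (2 * Real.pi), Real.cos_add_int_mul_two_pi]; exact h1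
  · rw [mul_comm (2 * Real.pi), Real.sin_add_int_mul_two_pi]; exact h2

/-- Positivity of `R + a'` excludes the origin, so the polar angle is determined modulo `2π`. The
strict bounds on `a'` and `b'` keep the points in the open annulus. -/
theorem closedSector_subset_sectorPoints {R c d a b a' b' : ℝ} (h0 : 0 < R + a') (ha : a ≤ a')
    (hb : b' ≤ b) (ha' : -(1 / √2) < a') (hb' : b' < 1 / √2) :
    closedSector (R + a') (R + b') c d ⊆ sectorPoints R c d a b := by
  rintro p ⟨r1, r2, t, ht, hp⟩
  refine ⟨⟨by linarith, by linarith⟩, ?_, ⟨by rw [radial]; linarith, by rw [radial]; linarith⟩⟩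
  have hq := eq_norm_mul_cos_angle p
  have hcos := cos_sub_eq_one_of_polar (h0.trans_le r1) hp.1 hp.2 hq.1 hq.2
  obtain ⟨n, hn⟩ := (Real.cos_eq_one_iff _).1 hcos
  refine ⟨n, ?_⟩
  have e : angle p + 2 * Real.pi * n = t := by linarith
  rw [e]
  exact ht

theorem one_div_sqrt_two_bounds : 1 / 2 ≤ 1 / √2 ∧ 1 / √2 ≤ 1 := by
  have h1 : 1 ≤ √2 := Real.one_le_sqrt.2 (by norm_num)
  have h2 : √2 ≤ 2 := by
    rw [Real.sqrt_le_left (by norm_num)]; norm_num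
  refine ⟨?_, ?_⟩
  · rw [div_le_div_iff₀ (by norm_num) (by linarith)]; linarith
  · rw [div_le_one (by linarith)]; exact h1

theorem abs_ncard_sectorPoints_sub_le {ε : ℝ} (hε : 0 < ε) (hε' : ε ≤ 1 / 3) :
    ∃ K : ℝ, 0 < K ∧ ∀ R c d a b : ℝ, 100 ≤ R → c ≤ d → d - c ≤ 2 * Real.pi →
      -(1 / √2) ≤ a → a ≤ b → b ≤ 1 / √2 →
      |((sectorPoints R c d a b).ncard : ℝ) - R * (d - c) * (b - a)|
        ≤ K * ((d - c) * R ^ (2 / 3 + ε) + R ^ (1 / 2 : ℝ)) := by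
  obtain ⟨K, hK, h⟩ := abs_ncard_closedSector_sub_le hε hε'
  refine ⟨K + 2, by positivity, ?_⟩
  intro R c d a b hR hcd hd ha hab hb
  have hR0 : 0 < R := by linarith
  obtain ⟨s1, s2⟩ := one_div_sqrt_two_bounds
  -- The annulus is open, so the lower bound moves the radii inwards by `η`. With `η = 1/R` the main
  -- term changes by at most `2(d - c)`.
  set η : ℝ := 1 / R with hη
  have hη0 : 0 < η := by positivity
  have hη1 : η ≤ 1 / 100 := one_div_le_one_div_of_le (by norm_num) hR
  have hRη : R * η = 1 := by rw [hη]; field_simp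
  set a' := max a (-(1 / √2) + η) with ha'
  set b' := min b (1 / √2 - η) with hb'
  have a1 : a ≤ a' := le_max_left _ _
  have a2 : -(1 / √2) + η ≤ a' := le_max_right _ _
  have a3 : a' ≤ a + η := max_le (by linarith) (by linarith)
  have b1 : b' ≤ b := min_le_left _ _
  have b2 : b' ≤ 1 / √2 - η := min_le_right _ _
  have b3 : b - η ≤ b' := le_min (by linarith) (by linarith)
  set T : ℝ := (d - c) * R ^ (2 / 3 + ε) + R ^ (1 / 2 : ℝ) with hT
  have hp1 : 1 ≤ R ^ (2 / 3 + ε) := Real.one_le_rpow (by linarith) (by linarith)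
  have hp2 : 0 < R ^ (1 / 2 : ℝ) := by positivity
  have hδ : 0 ≤ d - c := sub_nonneg.2 hcd
  have hTδ : d - c ≤ T := by nlinarith
  have upper : ((sectorPoints R c d a b).ncard : ℝ) ≤ R * (d - c) * (b - a) + K * T := by
    have := Set.ncard_le_ncard (sectorPoints_subset R c d a b) (closedSector_finite _ _ _ _)
    have t1 : ((sectorPoints R c d a b).ncard : ℝ) ≤ (closedSector (R + a) (R + b) c d).ncard := by
      exact_mod_cast this
    have t2 := abs_le.1 (h R (R + a) (R + b) c d hR (by linarith) (by linarith) (by linarith) hcd hd)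
    have e : (R + b - (R + a)) * R * (d - c) = R * (d - c) * (b - a) := by ring
    rw [e] at t2
    linarith [t2.2]
  have hRδ : 0 ≤ R * (d - c) := mul_nonneg hR0.le hδ
  have shrink : R * (d - c) * (b - a) ≤ R * (d - c) * (b' - a') + 2 * (d - c) := by
    have e : R * (d - c) * (2 * η) = 2 * (d - c) := by
      linear_combination (2 * (d - c)) * hRη
    have := mul_le_mul_of_nonneg_left (by linarith : b - a ≤ (b' - a') + 2 * η) hRδ
    linarith
  have lower : R * (d - c) * (b - a) - (K + 2) * T ≤ (sectorPoints R c d a b).ncard := by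
    have hKT : 0 ≤ K * T := mul_nonneg hK.le (by linarith)
    rcases le_or_gt a' b' with hle | hlt
    · have := Set.ncard_le_ncard (closedSector_subset_sectorPoints (R := R) (c := c) (d := d)
        (a := a) (b := b) (a' := a') (b' := b') (by linarith) a1 b1 (by linarith) (by linarith))
        (sectorPoints_finite _ _ _ _ _)
      have t1 : ((closedSector (R + a') (R + b') c d).ncard : ℝ)
          ≤ (sectorPoints R c d a b).ncard := by
        exact_mod_cast this
      have t2 := abs_le.1 (h R (R + a') (R + b') c d hR (by linarith) (by linarith) (by linarith)
        hcd hd)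
      have e : (R + b' - (R + a')) * R * (d - c) = R * (d - c) * (b' - a') := by ring
      rw [e] at t2
      linarith [t2.1]
    -- When the shrunken interval is empty, the main term is at most `2(d - c)`, and the lower bound
    -- is trivial.
    · have := mul_nonneg hRδ (sub_nonneg.2 hlt.le)
      have := Nat.cast_nonneg (α := ℝ) (sectorPoints R c d a b).ncard
      linarith
  rw [abs_le]
  constructor <;> linarith

theorem exists_ncard_sectorPoints_le (B : ℝ) :
    ∃ N : ℝ, 0 ≤ N ∧ ∀ R c d a b : ℝ, R ≤ B → ((sectorPoints R c d a b).ncard : ℝ) ≤ N := by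
  set S : Set (ℤ × ℤ) := Set.Icc (-⌈B + 1⌉) ⌈B + 1⌉ ×ˢ Set.Icc (-⌈B + 1⌉) ⌈B + 1⌉ with hS
  have hfin : S.Finite := (Set.finite_Icc _ _).prod (Set.finite_Icc _ _)
  refine ⟨S.ncard, Nat.cast_nonneg _, ?_⟩
  intro R c d a b hR
  have : sectorPoints R c d a b ⊆ S := by
    rintro p ⟨⟨-, h⟩, -⟩
    have hc : B + 1 ≤ (⌈B + 1⌉ : ℝ) := Int.le_ceil _
    have hn : ‖toPlane p‖ ≤ ⌈B + 1⌉ := by linarith [one_div_sqrt_two_bounds.2]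
    have h1 : |(p.1 : ℝ)| ≤ ⌈B + 1⌉ := (Complex.abs_re_le_norm (toPlane p)).trans hn
    have h2 : |(p.2 : ℝ)| ≤ ⌈B + 1⌉ := (Complex.abs_im_le_norm (toPlane p)).trans hn
    rw [abs_le] at h1 h2
    exact ⟨⟨by exact_mod_cast h1.1, by exact_mod_cast h1.2⟩,
      ⟨by exact_mod_cast h2.1, by exact_mod_cast h2.2⟩⟩
  exact_mod_cast Set.ncard_le_ncard this hfin

/-- This is the only use of the minimal width: with `s = 2/3 + ε` it absorbs the term `R^(1/2)`, and
it bounds the right side below when `R` is small. -/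
theorem rpow_le_of_le_width {R δ s : ℝ} (hR : 0 < R) (hδ : R ^ (-(1 / 2) : ℝ) ≤ δ) :
    R ^ (s - 1 / 6) ≤ δ ^ (1 / 3 : ℝ) * R ^ s := by
  have h1 := Real.rpow_le_rpow (by positivity) hδ (by norm_num : (0 : ℝ) ≤ 1 / 3)
  rw [← Real.rpow_mul hR.le] at h1
  have h2 := mul_le_mul_of_nonneg_right h1 (by positivity : 0 ≤ R ^ s)
  rw [← Real.rpow_add hR] at h2
  have e : s - 1 / 6 = -(1 / 2) * (1 / 3) + s := by ring
  rw [e]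
  exact h2

end GaussCircle

theorem mainTheorem10 :
    ∀ ε : ℝ, 0 < ε → ∃ C : ℝ, 0 < C ∧
      ∀ R c d a b : ℝ, 0 < R → c < d →
        R ^ (-(1 / 2) : ℝ) ≤ |d - c| → |d - c| ≤ 2 * Real.pi →
        -(1 / √2) ≤ a → a ≤ b → b ≤ 1 / √2 →
        |((GaussCircle.sectorPoints R c d a b).ncard : ℝ)
            - 2 * Real.pi * √2 * R * (|d - c| / (2 * Real.pi)) * ((b - a) / √2)|
          ≤ C * (|d - c| ^ (1 / 3 : ℝ) * R ^ (2 / 3 + ε : ℝ)) := by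
  intro ε hε
  -- The sector estimate requires exponent at most `1/3`; for `R ≥ 100`, enlarging `ε` only weakens
  -- the bound.
  obtain ⟨K, hK, hlarge⟩ := GaussCircle.abs_ncard_sectorPoints_sub_le (ε := min ε (1 / 3))
    (lt_min hε (by norm_num)) (min_le_right _ _)
  obtain ⟨N, hN, hsmall⟩ := GaussCircle.exists_ncard_sectorPoints_le 100
  have hκ : 0 < (1 / 49 : ℝ) ^ (1 / 2 + ε) := by positivity
  -- For `R ≥ 100` the two error terms are at most `7P` and `P`. For smaller `R` the count is at
  -- most `N` and the main term at most `100 · 7 · 2`.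
  refine ⟨8 * K + (N + 1400) / (1 / 49 : ℝ) ^ (1 / 2 + ε), by positivity, ?_⟩
  intro R c d a b hR hcd hlow hup ha hab hb
  rw [abs_of_pos (sub_pos.2 hcd)] at *
  have hδ : 0 < d - c := sub_pos.2 hcd
  have hpi := Real.pi_pos
  have hpi7 : 2 * Real.pi ≤ 7 := by linarith [Real.pi_lt_d2]
  have hmain : 2 * Real.pi * √2 * R * ((d - c) / (2 * Real.pi)) * ((b - a) / √2)
      = R * (d - c) * (b - a) := by
    field_simp
  rw [hmain]
  have hsw := GaussCircle.rpow_le_of_le_width (s := 2 / 3 + ε) hR hlow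
  set P := (d - c) ^ (1 / 3 : ℝ) * R ^ (2 / 3 + ε) with hP
  have hP0 : 0 < P := by positivity
  have hquot : 0 ≤ (N + 1400) / (1 / 49 : ℝ) ^ (1 / 2 + ε) := by positivity
  rcases le_or_gt 100 R with hR100 | hR100
  · have key := hlarge R c d a b hR100 hcd.le hup ha hab hb
    have p1 : R ^ (2 / 3 + min ε (1 / 3)) ≤ R ^ (2 / 3 + ε) :=
      Real.rpow_le_rpow_of_exponent_le (by linarith) (by linarith [min_le_left ε (1 / 3)])
    have p2 : R ^ (1 / 2 : ℝ) ≤ P :=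
      (Real.rpow_le_rpow_of_exponent_le (by linarith) (by linarith)).trans hsw
    have p3 : d - c ≤ 7 * (d - c) ^ (1 / 3 : ℝ) := by
      have e : d - c = (d - c) ^ (2 / 3 : ℝ) * (d - c) ^ (1 / 3 : ℝ) := by
        rw [← Real.rpow_add hδ]; norm_num
      have t1 : (d - c) ^ (2 / 3 : ℝ) ≤ 7 ^ (2 / 3 : ℝ) :=
        Real.rpow_le_rpow hδ.le (by linarith) (by norm_num)
      have t2 : (7 : ℝ) ^ (2 / 3 : ℝ) ≤ 7 := by
        have := Real.rpow_le_rpow_of_exponent_le (x := 7) (by norm_num)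
          (by norm_num : (2 / 3 : ℝ) ≤ 1)
        rwa [Real.rpow_one] at this
      calc d - c = (d - c) ^ (2 / 3 : ℝ) * (d - c) ^ (1 / 3 : ℝ) := e
        _ ≤ 7 * (d - c) ^ (1 / 3 : ℝ) :=
          mul_le_mul_of_nonneg_right (t1.trans t2) (by positivity)
    have p4 : (d - c) * R ^ (2 / 3 + min ε (1 / 3)) ≤ 7 * P := by
      rw [hP, ← mul_assoc]
      exact mul_le_mul p3 p1 (by positivity) (by positivity)
    refine key.trans ((mul_le_mul_of_nonneg_left (add_le_add p4 p2) hK.le).trans ?_)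
    nlinarith
  · have hRlow : 1 / 49 ≤ R := by
      have h7 : R ^ (-(1 / 2) : ℝ) ≤ 7 := by linarith
      rw [Real.rpow_neg hR.le, ← Real.sqrt_eq_rpow] at h7
      have h8 : 1 / 7 ≤ √R := by
        rw [one_div]
        exact inv_le_of_inv_le₀ (by positivity) h7
      have := pow_le_pow_left₀ (by norm_num) h8 2
      rw [Real.sq_sqrt hR.le] at this
      linarith
    have q1 : (1 / 49 : ℝ) ^ (1 / 2 + ε) ≤ P := by
      refine (Real.rpow_le_rpow (by norm_num) hRlow (by positivity)).trans ?_
      have e : 1 / 2 + ε = 2 / 3 + ε - 1 / 6 := by ring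
      rw [e]
      exact hsw
    have q2 := hsmall R c d a b hR100.le
    have q3 := Nat.cast_nonneg (α := ℝ) (GaussCircle.sectorPoints R c d a b).ncard
    have q4 : R * (d - c) * (b - a) ≤ 100 * 7 * 2 := by
      have := GaussCircle.one_div_sqrt_two_bounds.2
      refine mul_le_mul (mul_le_mul hR100.le (by linarith) hδ.le (by norm_num)) (by linarith)
        (by linarith) (by norm_num)
    have q5 : 0 ≤ R * (d - c) * (b - a) :=
      mul_nonneg (mul_nonneg hR.le hδ.le) (sub_nonneg.2 hab)
    have q6 : N + 1400 ≤ (N + 1400) / (1 / 49 : ℝ) ^ (1 / 2 + ε) * P := by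
      rw [div_mul_eq_mul_div, le_div_iff₀ hκ]
      exact mul_le_mul_of_nonneg_left q1 (by linarith)
    have q7 : 0 ≤ 8 * K * P := by positivity
    rw [abs_le]
    constructor <;> nlinarith
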